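/- **Setting.** All systems are finite-dimensional. An instrument $\mathfrak J=(\mathcal E_j)_{j\in\Theta}$ on $\mathcal B(\mathcal H)$ is a family of completely positive maps with a countable index set $\Theta$ such that $\sum_j\mathcal E_j$ is trace preserving. For a map $f:\Theta\to\Theta'$, the instrument with maps $\sum_{j\in f^{-1}(k)}\mathcal E_j$, $k\in\Theta'$, is called a coarse-graining of $\mathfrak J$. On $\mathcal H=\mathcal H^A\otimes\mathcal H^B$, an instrument is one-way local with respect to one party if each of its maps is $\mathcal E_j\otimes\mathcal T_j$ (up to the order of the factors), where $\mathcal E_j$ is a completely positive map on that party's system and $\mathcal T_j$ is a completely positive trace-preserving map on the other party's system. $\mathfrak J'$ is LOCC linked to $\mathfrak J=(\mathcal A_j)_j$ if it is a coarse-graining of an instrument with maps $\mathcal B_{j'|j}\circ\mathcal A_j$, where for each $j$ the family $(\mathcal B_{j'|j})_{j'}$ is one-way local with respect to a party that may depend on $j$. $\mathrm{LOCC}_1$ consists of the coarse-grainings of one-way local instruments, $\mathrm{LOCC}_{r+1}$ of the instruments that are LOCC linked to an instrument in $\mathrm{LOCC}_r$, and $\mathrm{LOCC}_{\mathbb N}=\bigcup_{r\ge1}\mathrm{LOCC}_r$.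 For finite $\Theta$, the distance of two instruments over $\Theta$ is $D_\diamond(\mathfrak J,\tilde{\mathfrak J})=\bigl\|\sum_j(\mathcal E_j-\tilde{\mathcal E}_j)(\cdot)\otimes|j\rangle\langle j|\bigr\|_\diamond$, with $\|\cdot\|_\diamond$ the diamond norm. $\mathrm{LOCC}$ consists of the instruments $\mathfrak J$ for which there are $\mathfrak J_1,\mathfrak J_2,\dots\in\mathrm{LOCC}_{\mathbb N}$, each $\mathfrak J_{\nu+1}$ LOCC linked to $\mathfrak J_\nu$, and coarse-grainings $\mathfrak J'_\nu$ of $\mathfrak J_\nu$ that converge to $\mathfrak J$ in $D_\diamond$. Closures are taken in the set of all instruments over the same finite $\Theta$ with respect to $D_\diamond$. $\mathrm{SEP}$ consists of the instruments each of whose maps $\mathcal E_j$ is separable, i.e. for all auxiliary systems $A',B'$ the map $\mathcal I^{A'B'}\otimes\mathcal E_j$ takes states that are separable across $A'A:B'B$ to (unnormalized) states that are separable across $A'A:B'B$. The concurrence of a two-qubit pure state $\psi=\sum_{a,b}\psi_{ab}|ab\rangle$ is $C(\psi)=2|\psi_{00}\psi_{11}-\psi_{01}\psi_{10}|$, and that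 of a mixed state is the convex roof $C(\rho)=\inf\sum_ip_iC(\psi_i)$ over all finite decompositions $\rho=\sum_ip_i|\psi_i\rangle\langle\psi_i|$ into unit vectors with $p_i\ge 0$. **Statement.** On two qubits $A,B$ let $\mathcal E_i(\rho)=\Pi_i\rho\,\Pi_i^\dagger$, $i=1,2,3$, where $$\Pi_1=\Bigl(\tfrac1{\sqrt2}|0\rangle\langle0|+|1\rangle\langle1|\Bigr)\otimes|0\rangle\langle0|,\qquad \Pi_2=|0\rangle\langle0|\otimes\Bigl(\tfrac1{\sqrt2}|0\rangle\langle0|+|1\rangle\langle1|\Bigr),\qquad \Pi_3=|1\rangle\langle1|\otimes|1\rangle\langle1|.$$ 1. $\sum_{i=1}^3\Pi_i^\dagger\Pi_i=I$, and $\mathfrak J=(\mathcal E_1,\mathcal E_2,\mathcal E_3)$ is an instrument in $\mathrm{SEP}$. 2. Apply $\mathfrak J$ to the qubits $A,B$ of $|W\rangle=\frac1{\sqrt3}(|100\rangle+|010\rangle+|001\rangle)_{ABC}$. The outcomes $1,2,3$ have probabilities $p_1=p_2=\frac12$ and $p_3=0$. The normalized state after outcome $1$ is $\omega_1^{AC}\otimes|0\rangle\langle0|^B$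 and after outcome $2$ it is $|0\rangle\langle0|^A\otimes\omega_2^{BC}$, for two-qubit states $\omega_1,\omega_2$ whose average concurrence is $$p_1C(\omega_1)+p_2C(\omega_2)=\frac{2\sqrt2}{3}>\frac89 .$$ 3. $\mathfrak J\notin\overline{\mathrm{LOCC}_{\mathbb N}}$ and $\mathfrak J\notin\overline{\mathrm{LOCC}}$. In particular $\mathrm{SEP}\not\subseteq\overline{\mathrm{LOCC}}$ for two-qubit instruments with three outcomes. -/

import Mathlib

open scoped Kronecker ENNReal ComplexOrder
open Filter Topology

noncomputable section

namespace LOCCGap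

/-! ### Superoperators, complete positivity, tensor products -/

/-- Linear maps `B(H) → B(H')` in matrix form; `n`, `m` index the standard bases. -/
abbrev SuperOp (n m : Type) : Type := Matrix n n ℂ →ₗ[ℂ] Matrix m m ℂ

/-- `id_k ⊗ Φ`: apply `Φ` to every block of a block matrix. -/
def idTensor (k : Type) {n m : Type} (Φ : SuperOp n m) : SuperOp (k × n) (k × m) where
  toFun X := Matrix.of fun p q => Φ (Matrix.of fun i j => X (p.1, i) (q.1, j)) p.2 q.2
  map_add' X Y := by
    ext p q
    exact congrFun (congrFun (map_add Φ (Matrix.of fun i j => X (p.1, i) (q.1, j))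
      (Matrix.of fun i j => Y (p.1, i) (q.1, j))) p.2) q.2
  map_smul' c X := by
    ext p q
    exact congrFun (congrFun (map_smul Φ c
      (Matrix.of fun i j => X (p.1, i) (q.1, j))) p.2) q.2

/-- `Φ ⊗ id_k`. -/
def tensorId {n m : Type} (Φ : SuperOp n m) (k : Type) : SuperOp (n × k) (m × k) where
  toFun X := Matrix.of fun p q => Φ (Matrix.of fun i j => X (i, p.2) (j, q.2)) p.1 q.1
  map_add' X Y := by
    ext p q
    exact congrFun (congrFun (map_add Φ (Matrix.of fun i j => X (i, p.2) (j, q.2))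
      (Matrix.of fun i j => Y (i, p.2) (j, q.2))) p.1) q.1
  map_smul' c X := by
    ext p q
    exact congrFun (congrFun (map_smul Φ c
      (Matrix.of fun i j => X (i, p.2) (j, q.2))) p.1) q.1

/-- `Φ ⊗ Ψ = (Φ ⊗ id) ∘ (id ⊗ Ψ)`. -/
def tensor {n m k l : Type} (Φ : SuperOp n m) (Ψ : SuperOp k l) : SuperOp (n × k) (m × l) :=
  tensorId Φ l ∘ₗ idTensor n Ψ

/-- The defining property of the tensor product of two superoperators. -/
theorem tensor_kronecker {n m k l : Type} (Φ : SuperOp n m) (Ψ : SuperOp k l)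
    (X : Matrix n n ℂ) (Y : Matrix k k ℂ) : tensor Φ Ψ (X ⊗ₖ Y) = Φ X ⊗ₖ Ψ Y := by
  ext p q
  have h1 : ∀ i j : n, Ψ (Matrix.of fun a b => (X ⊗ₖ Y) (i, a) (j, b)) = X i j • Ψ Y :=
    fun i j => map_smul Ψ (X i j) Y
  have h2 : (Matrix.of fun i j => idTensor n Ψ (X ⊗ₖ Y) (i, p.2) (j, q.2) : Matrix n n ℂ)
      = (Ψ Y p.2 q.2) • X := by
    ext i j
    change Ψ (Matrix.of fun a b => (X ⊗ₖ Y) (i, a) (j, b)) p.2 q.2 = _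
    rw [h1, Matrix.smul_apply, Matrix.smul_apply, smul_eq_mul, smul_eq_mul, mul_comm]
  change Φ (Matrix.of fun i j => idTensor n Ψ (X ⊗ₖ Y) (i, p.2) (j, q.2)) p.1 q.1
    = Φ X p.1 q.1 * Ψ Y p.2 q.2
  rw [h2, map_smul, Matrix.smul_apply, smul_eq_mul, mul_comm]

/-- Complete positivity. -/
def IsCP {n m : Type} (Φ : SuperOp n m) : Prop :=
  ∀ (k : ℕ) (X : Matrix (Fin k × n) (Fin k × n) ℂ),
    X.PosSemidef → (idTensor (Fin k) Φ X).PosSemidef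

/-- Trace preservation. -/
def IsTP {n m : Type} [Fintype n] [Fintype m] (Φ : SuperOp n m) : Prop :=
  ∀ X : Matrix n n ℂ, (Φ X).trace = X.trace

/-- The map `X ↦ M X M†`. -/
def krausMap {n : Type} [Fintype n] (M : Matrix n n ℂ) : SuperOp n n where
  toFun X := M * X * M.conjTranspose
  map_add' X Y := by rw [Matrix.mul_add, Matrix.add_mul]
  map_smul' c X := by simp

/-! ### Instruments and their distance -/

/-- Families of superoperators on one system, indexed by the outcomes. -/
abbrev Family (Θ n : Type) : Type := Θ → SuperOp n n

/-- A quantum instrument with countable outcome set: completely positive maps whose sum exists and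
is trace preserving. -/
def IsInstrument {Θ n : Type} [Fintype n] (J : Family Θ n) : Prop :=
  Countable Θ ∧ (∀ j, IsCP (J j)) ∧
    ∃ T : SuperOp n n, IsTP T ∧ ∀ X, HasSum (fun j => J j X) (T X)

/-- `F` is obtained from `J` by the coarse-graining map `f`, i.e. `F k = ∑_{f j = k} J j`. -/
def IsCoarseGraining {Θ Θ' n : Type} (F : Family Θ' n) (J : Family Θ n) : Prop :=
  ∃ f : Θ → Θ', ∀ k X, HasSum (fun j : {j : Θ // f j = k} => J j X) (F k X)

/-- The trace norm `tr √(X†X)`, the sum of the singular values of `X`. -/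
def traceNorm {n : Type} [Fintype n] [DecidableEq n] (X : Matrix n n ℂ) : ℝ :=
  ∑ i, Real.sqrt ((Matrix.isHermitian_conjTranspose_mul_self X).eigenvalues i)

/-- The diamond norm: the supremum of `‖(id_k ⊗ Φ) X‖₁` over all `k` and all `X` with
`‖X‖₁ ≤ 1`. -/
def diamondNorm {n m : Type} [Fintype n] [DecidableEq n] [Fintype m] [DecidableEq m]
    (Φ : SuperOp n m) : ℝ≥0∞ :=
  ⨆ (k : ℕ) (X : Matrix (Fin k × n) (Fin k × n) ℂ) (_ : traceNorm X ≤ 1),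
    ENNReal.ofReal (traceNorm (idTensor (Fin k) Φ X))

/-- The map `X ↦ ∑ⱼ Eⱼ(X) ⊗ |j⟩⟨j|` associated with a family with finitely many outcomes. -/
def toChannel {Θ n : Type} [DecidableEq Θ] (J : Family Θ n) : SuperOp n (n × Θ) where
  toFun X := Matrix.blockDiagonal fun j => J j X
  map_add' X Y := by
    rw [← Matrix.blockDiagonal_add]
    congr 1
    funext j
    simp
  map_smul' c X := by
    rw [RingHom.id_apply, ← Matrix.blockDiagonal_smul]
    congr 1
    funext j
    simp

/-- The diamond distance of two instruments over the same finite outcome set. -/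
def instrDist {Θ n : Type} [Fintype Θ] [DecidableEq Θ] [Fintype n] [DecidableEq n]
    (J J' : Family Θ n) : ℝ≥0∞ :=
  diamondNorm (toChannel J - toChannel J')

/-- Convergence of a sequence of instruments over a finite outcome set. -/
def ConvergesTo {Θ n : Type} [Fintype Θ] [DecidableEq Θ] [Fintype n] [DecidableEq n]
    (Js : ℕ → Family Θ n) (J : Family Θ n) : Prop :=
  Tendsto (fun ν => instrDist (Js ν) J) atTop (𝓝 0)

/-- The closure of a class of instruments inside the set of all instruments. -/
def instrClosure {Θ n : Type} [Fintype Θ] [DecidableEq Θ] [Fintype n] [DecidableEq n]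
    (S : Set (Family Θ n)) : Set (Family Θ n) :=
  {J | IsInstrument J ∧ ∃ Js : ℕ → Family Θ n, (∀ ν, Js ν ∈ S) ∧ ConvergesTo Js J}

/-! ### Bipartite LOCC -/

/-- The two parties. -/
inductive Party : Type
  | alice
  | bob

section Bipartite

variable {A B : Type} [Fintype A] [DecidableEq A] [Fintype B] [DecidableEq B]

/-- One-way local instruments: party `K` applies an instrument and broadcasts the outcome `j`,
upon which the other party applies a channel depending on `j`. -/
def IsOneWayLocal {Θ : Type} (K : Party) (J : Family Θ (A × B)) : Prop :=
  IsInstrument J ∧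
    match K with
    | .alice => ∀ j, ∃ (E : SuperOp A A) (T : SuperOp B B),
        IsCP E ∧ IsCP T ∧ IsTP T ∧ J j = tensor E T
    | .bob => ∀ j, ∃ (T : SuperOp A A) (E : SuperOp B B),
        IsCP T ∧ IsTP T ∧ IsCP E ∧ J j = tensor T E

/-- `J'` is LOCC linked to `J`: after outcome `j` of `J`, a one-way local instrument `Bs j` (whose
acting party and outcome set may depend on `j`) is applied, followed by coarse-graining. -/
def IsLOCCLinked {Θ Θ' : Type} (J' : Family Θ' (A × B)) (J : Family Θ (A × B)) : Prop :=
  ∃ (K : Θ → Party) (Ξ : Θ → Type) (Bs : ∀ j, Family (Ξ j) (A × B)),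
    (∀ j, IsOneWayLocal (K j) (Bs j)) ∧
    IsCoarseGraining J' (fun x : (Σ j, Ξ j) => Bs x.1 x.2 ∘ₗ J x.1)

/-- `InLOCC r J` says that the instrument `J` belongs to `LOCC_r`, for `r = 1, 2, …`. -/
inductive InLOCC : ℕ → ∀ {Θ : Type}, Family Θ (A × B) → Prop
  | one {Θ Θ' : Type} [Countable Θ'] (K : Party) (J : Family Θ (A × B))
      (J' : Family Θ' (A × B)) :
      IsOneWayLocal K J → IsCoarseGraining J' J → InLOCC 1 J'
  | succ {Θ Θ' : Type} [Countable Θ'] (r : ℕ) (J : Family Θ (A × B))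
      (J' : Family Θ' (A × B)) :
      InLOCC r J → IsLOCCLinked J' J → InLOCC (r + 1) J'

/-- Instruments implementable with finitely many rounds of LOCC. -/
def LOCCN (Θ A B : Type) [Fintype A] [DecidableEq A] [Fintype B] [DecidableEq B] :
    Set (Family Θ (A × B)) := {J | ∃ r, InLOCC r J}

/-- `LOCC`, including protocols with infinitely many rounds: `J` is the limit of coarse-grainings
of the successive steps of one fixed protocol. -/
def LOCC (Θ A B : Type) [Fintype Θ] [DecidableEq Θ] [Fintype A] [DecidableEq A]
    [Fintype B] [DecidableEq B] : Set (Family Θ (A × B)) :=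
  {J | IsInstrument J ∧
    ∃ (Ξ : ℕ → Type) (Js : ∀ ν, Family (Ξ ν) (A × B)) (Js' : ℕ → Family Θ (A × B)),
      (∀ ν, Js ν ∈ LOCCN (Ξ ν) A B) ∧
      (∀ ν, IsLOCCLinked (Js (ν + 1)) (Js ν)) ∧
      (∀ ν, IsCoarseGraining (Js' ν) (Js ν)) ∧
      ConvergesTo Js' J}

end Bipartite

/-! ### Separable instruments -/

/-- Density matrices. -/
def IsDensity {n : Type} [Fintype n] (ρ : Matrix n n ℂ) : Prop :=
  ρ.PosSemidef ∧ ρ.trace = 1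

/-- Separable bipartite states: convex combinations of product states. -/
def separableStates (n m : Type) [Fintype n] [Fintype m] :
    Set (Matrix (n × m) (n × m) ℂ) :=
  convexHull ℝ {σ | ∃ (α : Matrix n n ℂ) (β : Matrix m m ℂ),
    IsDensity α ∧ IsDensity β ∧ σ = α ⊗ₖ β}

/-- A separable map: for all auxiliary systems `A'`, `B'`, the map `id_{A'B'} ⊗ Φ` takes states
that are separable with respect to `A'A : B'B` to (unnormalized) states that are separable with
respect to the same partition. -/
def IsSeparableMap {A B : Type} [Fintype A] [Fintype B] (Φ : SuperOp (A × B) (A × B)) : Prop :=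
  ∀ (a b : ℕ), ∀ ρ ∈ separableStates (Fin a × A) (Fin b × B),
    ∃ t : ℝ, 0 ≤ t ∧ ∃ σ ∈ separableStates (Fin a × A) (Fin b × B),
      (idTensor (Fin a × Fin b) Φ
        (ρ.reindex (Equiv.prodProdProdComm (Fin a) A (Fin b) B)
          (Equiv.prodProdProdComm (Fin a) A (Fin b) B))).reindex
        (Equiv.prodProdProdComm (Fin a) (Fin b) A B)
        (Equiv.prodProdProdComm (Fin a) (Fin b) A B) = t • σ

/-- Separable instruments. -/
def SEP (Θ A B : Type) [Fintype A] [Fintype B] : Set (Family Θ (A × B)) :=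
  {J | IsInstrument J ∧ ∀ j, IsSeparableMap (J j)}

/-! ### Qubits and concurrence -/

/-- The operator `|ψ⟩⟨ψ|`. -/
def pureState {n : Type} (ψ : n → ℂ) : Matrix n n ℂ := Matrix.vecMulVec ψ (star ψ)

/-- Concurrence of the two-qubit pure state with amplitudes `ψ`. -/
def pureConcurrence (ψ : Fin 2 × Fin 2 → ℂ) : ℝ :=
  2 * ‖ψ (0, 0) * ψ (1, 1) - ψ (0, 1) * ψ (1, 0)‖

/-- Concurrence of a two-qubit state: the convex roof of the pure-state concurrence, the infimum
being over all finite decompositions of `ρ` into unit vectors. -/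
def concurrence (ρ : Matrix (Fin 2 × Fin 2) (Fin 2 × Fin 2) ℂ) : ℝ :=
  sInf {r | ∃ (N : ℕ) (p : Fin N → ℝ) (ψ : Fin N → Fin 2 × Fin 2 → ℂ),
    (∀ i, 0 ≤ p i) ∧ (∀ i, ∑ x, ‖ψ i x‖ ^ 2 = 1) ∧
    ρ = ∑ i, (p i : ℂ) • pureState (ψ i) ∧ r = ∑ i, p i * pureConcurrence (ψ i)}

/-- Indices of the three-qubit system `(A, B), C`. -/
abbrev Qubits3 : Type := (Fin 2 × Fin 2) × Fin 2

/-- `|W⟩ = (|100⟩ + |010⟩ + |001⟩) / √3`. -/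
def wState : Qubits3 → ℂ := fun x =>
  if x = ((1, 0), 0) ∨ x = ((0, 1), 0) ∨ x = ((0, 0), 1) then 1 / (Real.sqrt 3 : ℂ) else 0

/-- `ω^{AC} ⊗ |0⟩⟨0|^B`. -/
def placeAC (ω : Matrix (Fin 2 × Fin 2) (Fin 2 × Fin 2) ℂ) : Matrix Qubits3 Qubits3 ℂ :=
  Matrix.of fun x y =>
    if x.1.2 = 0 ∧ y.1.2 = 0 then ω (x.1.1, x.2) (y.1.1, y.2) else 0

/-- `|0⟩⟨0|^A ⊗ ω^{BC}`. -/
def placeBC (ω : Matrix (Fin 2 × Fin 2) (Fin 2 × Fin 2) ℂ) : Matrix Qubits3 Qubits3 ℂ :=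
  Matrix.of fun x y =>
    if x.1.1 = 0 ∧ y.1.1 = 0 then ω (x.1.2, x.2) (y.1.2, y.2) else 0

/-- `|0⟩⟨0|` on a qubit. -/
def proj0 : Matrix (Fin 2) (Fin 2) ℂ := !![1, 0; 0, 0]

/-- `|1⟩⟨1|` on a qubit. -/
def proj1 : Matrix (Fin 2) (Fin 2) ℂ := !![0, 0; 0, 1]

/-- The Kraus operators `Π₁, Π₂, Π₃` (indexed by `0, 1, 2`). -/
def krausOp : Fin 3 → Matrix (Fin 2 × Fin 2) (Fin 2 × Fin 2) ℂ :=
  ![((1 / (Real.sqrt 2 : ℂ)) • proj0 + proj1) ⊗ₖ proj0,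
    proj0 ⊗ₖ ((1 / (Real.sqrt 2 : ℂ)) • proj0 + proj1),
    proj1 ⊗ₖ proj1]

/-- The instrument `ρ ↦ Πᵢ ρ Πᵢ†`, `i = 1, 2, 3`. -/
def piInstrument : Family (Fin 3) (Fin 2 × Fin 2) := fun i => krausMap (krausOp i)

/-- The unnormalized tripartite state after outcome `i` when `A` and `B` apply the instrument to
their part of `|W⟩`. -/
def outputOnW (i : Fin 3) : Matrix Qubits3 Qubits3 ℂ :=
  tensorId (piInstrument i) (Fin 2) (pureState wState)

end LOCCGap

end

open LOCCGap

/-!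
The separation between the given instrument and LOCC is detected by `coherence`, the sum of
`|⟨10| J₁(|10⟩⟨00|) |00⟩|` and `|⟨01| J₂(|01⟩⟨00|) |00⟩|`, where `J₁` and `J₂` are the maps of the
outcomes with index `0` and `1`. It equals `√2` for the given instrument
(`coherence_piInstrument`) and is at most `4 / 3` for every finite-round LOCC instrument
(`IsMonotoneDecomposable.coherence_le`). It depends on finitely many matrix entries, which the
diamond distance controls (`ConvergesTo.tendsto_apply`), so the bound persists under limits.

For the bound, refine a protocol until each of its maps is a product `E ⊗ F` of completely positive
maps, and let `(p, m)` and `(q, n)` be the diagonals of the effects `E†(1)` and `F†(1)`. By complete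
positivity the two coherences of `E ⊗ F` are at most `√(m p) q` and `√(n q) p`. Both are dominated
by a function `potential p m q n` that is homogeneous and concave in `(p, m)` for fixed `(q, n)` and
vice versa, hence superadditive in each pair (`potential_superadditive`). When one party acts, its
effect is split into a sum, while the effect of the other party, who applies a channel, does not
change. The sum of the potentials over all product maps therefore never increases from its initial
value `potential 1 1 1 1 = 4 / 3`. In the coordinates `a = m / p`, `b = n / q`, and for `a ≤ b`,
the potential is `p q (√b + a / (3 √b))`; the coefficient `1 / 3` is the least one for which the two
branches, interchanged by exchanging the parties, meet in a concave function.

Outcome sets are countable, so the refinement of a coarse-graining involves iterated infinite sums.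
Their summability comes from a second monotone, `(p + m) (q + n)`, which bounds the entries of
`E ⊗ F`.

The Kraus operators are products, which makes the instrument separable. The states it produces from
`|W⟩` are pure, and a pure state has only trivial decompositions, so that their concurrences are
those of the state vectors.
-/

noncomputable section

namespace LOCCGap

/-! ### A biconcave potential -/

/-- The potential in the coordinates `a = m / p`, `b = n / q` of two diagonal effects
`diag(p, m)`, `diag(q, n)`: `√M + μ / (3 √M)` with `M = max a b` and `μ = min a b`. It dominates
`max √a √b` and is concave and nondecreasing in each variable. At `a = b = 0` division by zero gives
the limit value `0`. -/
def ratioPotential (a b : ℝ) : ℝ :=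
  if a ≤ b then √b + a / (3 * √b) else √a + b / (3 * √a)

theorem ratioPotential_comm (a b : ℝ) : ratioPotential a b = ratioPotential b a := by
  unfold ratioPotential
  rcases lt_trichotomy a b with h | h | h
  · rw [if_pos h.le, if_neg h.not_ge]
  · rw [h]
  · rw [if_neg h.not_ge, if_pos h.le]

theorem sqrt_le_ratioPotential {a b : ℝ} (ha : 0 ≤ a) (hb : 0 ≤ b) :
    √a ≤ ratioPotential a b := by
  unfold ratioPotential
  split_ifs with h
  · have := Real.sqrt_le_sqrt h
    have : 0 ≤ a / (3 * √b) := by positivity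
    linarith
  · have : 0 ≤ b / (3 * √a) := by positivity
    linarith

/-- The supergradient inequality for `ratioPotential`, in the square roots of its arguments. The
differences of the two sides factor as cubes, or as squares times a nonnegative factor. -/
theorem exists_supergradient_sq {x₀ y : ℝ} (hx₀ : 0 ≤ x₀) (hy : 0 ≤ y) (hpos : 0 < x₀ ∨ 0 < y) :
    ∃ c, 0 ≤ c ∧ ∀ x, 0 ≤ x →
      (if x ≤ y then y + x ^ 2 / (3 * y) else x + y ^ 2 / (3 * x)) ≤
        (if x₀ ≤ y then y + x₀ ^ 2 / (3 * y) else x₀ + y ^ 2 / (3 * x₀)) +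
          c * (x ^ 2 - x₀ ^ 2) := by
  by_cases h₀ : x₀ ≤ y
  · have hy' : 0 < y := by rcases hpos with h | h <;> linarith
    refine ⟨1 / (3 * y), by positivity, fun x hx => ?_⟩
    rw [if_pos h₀]
    split_ifs with h
    · apply le_of_eq
      field_simp
      ring
    · have hxy : y < x := not_le.1 h
      have hx' : 0 < x := hy'.trans hxy
      rw [← sub_nonneg]
      have : y + x₀ ^ 2 / (3 * y) + 1 / (3 * y) * (x ^ 2 - x₀ ^ 2) - (x + y ^ 2 / (3 * x)) =
          (x - y) ^ 3 / (3 * x * y) := by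
        field_simp
        ring
      rw [this]
      have : 0 ≤ x - y := by linarith
      positivity
  · have hlt : y < x₀ := not_le.1 h₀
    have hx₀' : 0 < x₀ := hy.trans_lt hlt
    have hyx : y ^ 2 ≤ x₀ ^ 2 := pow_le_pow_left₀ hy hlt.le 2
    refine ⟨(3 * x₀ ^ 2 - y ^ 2) / (6 * x₀ ^ 3), ?_, fun x hx => ?_⟩
    · apply div_nonneg _ (by positivity)
      nlinarith
    rw [if_neg h₀]
    split_ifs with h
    · rcases hy.eq_or_lt with rfl | hy'
      · have : x = 0 := le_antisymm h hx
        subst this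
        rw [← sub_nonneg]
        field_simp
        nlinarith [sq_nonneg (x₀ ^ 2)]
      rw [← sub_nonneg]
      have key : x₀ + y ^ 2 / (3 * x₀) + (3 * x₀ ^ 2 - y ^ 2) / (6 * x₀ ^ 3) * (x ^ 2 - x₀ ^ 2) -
          (y + x ^ 2 / (3 * y)) =
          (x₀ - y) ^ 2 * (3 * x₀ ^ 2 * y - x ^ 2 * (2 * x₀ + y)) / (6 * x₀ ^ 3 * y) := by
        field_simp
        ring
      rw [key]
      apply div_nonneg (mul_nonneg (sq_nonneg _) _) (by positivity)
      have h1 : x ^ 2 * x₀ ≤ x₀ ^ 2 * y := by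
        have : x * x ≤ x₀ * y := mul_le_mul (h.trans hlt.le) h hx hx₀
        nlinarith
      have h2 : x ^ 2 * y ≤ x₀ ^ 2 * y :=
        mul_le_mul_of_nonneg_right (pow_le_pow_left₀ hx (h.trans hlt.le) 2) hy
      nlinarith
    · have hxy : y < x := not_le.1 h
      have hx' : 0 < x := hy.trans_lt hxy
      rw [← sub_nonneg]
      have key : x₀ + y ^ 2 / (3 * x₀) + (3 * x₀ ^ 2 - y ^ 2) / (6 * x₀ ^ 3) * (x ^ 2 - x₀ ^ 2) -
          (x + y ^ 2 / (3 * x)) =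
          (x - x₀) ^ 2 * (3 * x₀ ^ 2 * x - y ^ 2 * (x + 2 * x₀)) / (6 * x₀ ^ 3 * x) := by
        field_simp
        ring
      rw [key]
      apply div_nonneg (mul_nonneg (sq_nonneg _) _) (by positivity)
      have h1 : y ^ 2 * x ≤ x₀ ^ 2 * x := mul_le_mul_of_nonneg_right hyx hx
      have h2 : y ^ 2 * x₀ ≤ x₀ ^ 2 * x := by
        have : y * y ≤ x₀ * x := mul_le_mul hlt.le hxy.le hy hx₀
        nlinarith
      nlinarith

theorem exists_supergradient {a₀ b : ℝ} (ha₀ : 0 ≤ a₀) (hb : 0 ≤ b) (hpos : 0 < a₀ ∨ 0 < b) :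
    ∃ c, 0 ≤ c ∧ ∀ a, 0 ≤ a →
      ratioPotential a b ≤ ratioPotential a₀ b + c * (a - a₀) := by
  obtain ⟨c, hc, H⟩ := exists_supergradient_sq (Real.sqrt_nonneg a₀) (Real.sqrt_nonneg b)
    (hpos.imp Real.sqrt_pos.2 Real.sqrt_pos.2)
  refine ⟨c, hc, fun a ha => ?_⟩
  have := H √a (Real.sqrt_nonneg a)
  simpa only [ratioPotential, Real.sqrt_le_sqrt_iff hb, Real.sq_sqrt ha, Real.sq_sqrt ha₀, Real.sq_sqrt hb]
    using this

theorem ratioPotential_nonneg {a b : ℝ} (ha : 0 ≤ a) (hb : 0 ≤ b) : 0 ≤ ratioPotential a b :=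
  (Real.sqrt_nonneg a).trans (sqrt_le_ratioPotential ha hb)

/-- The potential of a pair of diagonal effects `diag(p, m)`, `diag(q, n)`. It vanishes for `p = 0`
and for `q = 0`, in accordance with the limits there. -/
def potential (p m q n : ℝ) : ℝ := p * q * ratioPotential (m / p) (n / q)

theorem potential_comm (p m q n : ℝ) : potential p m q n = potential q n p m := by
  rw [potential, potential, ratioPotential_comm, mul_comm p q]

theorem potential_one : potential 1 1 1 1 = 4 / 3 := by
  norm_num [potential, ratioPotential]

theorem mul_ratioPotential_mono {p m₁ m₂ b : ℝ} (hp : 0 ≤ p) (h₁ : 0 ≤ m₁) (h₂ : 0 ≤ m₂)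
    (hb : 0 ≤ b) : p * ratioPotential (m₂ / p) b ≤ p * ratioPotential ((m₁ + m₂) / p) b := by
  rcases hp.eq_or_lt with rfl | hp'
  · simp
  apply mul_le_mul_of_nonneg_left _ hp
  by_cases hpos : 0 < (m₁ + m₂) / p ∨ 0 < b
  · obtain ⟨c, hc, H⟩ := exists_supergradient (by positivity) hb hpos
    have h := H (m₂ / p) (by positivity)
    have : m₂ / p - (m₁ + m₂) / p ≤ 0 := by
      rw [← sub_div]
      apply div_nonpos_of_nonpos_of_nonneg _ hp
      linarith
    nlinarith
  -- There is no supergradient at the origin, but `m₁ = 0` there.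
  · push Not at hpos
    have h0 : m₁ + m₂ ≤ 0 := by
      have := hpos.1
      rwa [div_le_iff₀ hp', zero_mul] at this
    have : m₁ = 0 := by linarith
    simp [this]

/-- Local processing of one effect does not increase the potential: this is concavity of
`ratioPotential` together with homogeneity. -/
theorem potential_superadditive {p₁ m₁ p₂ m₂ q n : ℝ} (hp₁ : 0 ≤ p₁) (hm₁ : 0 ≤ m₁) (hp₂ : 0 ≤ p₂)
    (hm₂ : 0 ≤ m₂) (hq : 0 ≤ q) (hn : 0 ≤ n) :
    potential p₁ m₁ q n + potential p₂ m₂ q n ≤ potential (p₁ + p₂) (m₁ + m₂) q n := by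
  have hb : 0 ≤ n / q := by positivity
  suffices h : p₁ * ratioPotential (m₁ / p₁) (n / q) + p₂ * ratioPotential (m₂ / p₂) (n / q) ≤
      (p₁ + p₂) * ratioPotential ((m₁ + m₂) / (p₁ + p₂)) (n / q) by
    have := mul_le_mul_of_nonneg_left h hq
    unfold potential
    linarith
  generalize n / q = b at hb
  rcases hp₁.eq_or_lt with rfl | hp₁'
  · simpa using mul_ratioPotential_mono hp₂ hm₁ hm₂ hb
  rcases hp₂.eq_or_lt with rfl | hp₂'
  · simpa [add_comm] using mul_ratioPotential_mono hp₁ hm₂ hm₁ hb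
  by_cases hpos : 0 < (m₁ + m₂) / (p₁ + p₂) ∨ 0 < b
  · obtain ⟨c, hc, H⟩ := exists_supergradient (by positivity) hb hpos
    have h₁ := mul_le_mul_of_nonneg_left (H (m₁ / p₁) (by positivity)) hp₁
    have h₂ := mul_le_mul_of_nonneg_left (H (m₂ / p₂) (by positivity)) hp₂
    have e : p₁ * (m₁ / p₁ - (m₁ + m₂) / (p₁ + p₂)) + p₂ * (m₂ / p₂ - (m₁ + m₂) / (p₁ + p₂)) = 0 := by
      field_simp
      ring
    linear_combination h₁ + h₂ + c * e
  -- There is no supergradient at the origin, but both sides are equal for `m₁ = m₂ = 0`.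
  · push Not at hpos
    have h0 : m₁ + m₂ ≤ 0 := by
      have := hpos.1
      rwa [div_le_iff₀ (by positivity), zero_mul] at this
    have e₁ : m₁ = 0 := by linarith
    have e₂ : m₂ = 0 := by linarith
    apply le_of_eq
    simp [e₁, e₂]
    ring

/-- The left-hand side is the largest coherence that a product map with these effects can have. -/
theorem mul_sqrt_le_potential {p m q n : ℝ} (hp : 0 ≤ p) (hm : 0 ≤ m) (hq : 0 ≤ q) (hn : 0 ≤ n) :
    √(m * p) * q ≤ potential p m q n := by
  have h : √(m * p) = p * √(m / p) := by
    rcases hp.eq_or_lt with rfl | hp'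
    · simp
    rw [Real.sqrt_div hm, Real.sqrt_mul hm]
    have h2 := Real.sq_sqrt hp
    have h1 : √p ≠ 0 := (Real.sqrt_pos.2 hp').ne'
    field_simp
    rw [h2]
  have := sqrt_le_ratioPotential (a := m / p) (b := n / q) (by positivity) (by positivity)
  rw [h, potential]
  have := mul_le_mul_of_nonneg_left this (mul_nonneg hp hq)
  linarith

theorem potential_nonneg {p m q n : ℝ} (hp : 0 ≤ p) (hm : 0 ≤ m) (hq : 0 ≤ q) (hn : 0 ≤ n) :
    0 ≤ potential p m q n :=
  mul_nonneg (mul_nonneg hp hq) (ratioPotential_nonneg (by positivity) (by positivity))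

/-! ### Completely positive maps and tensor products -/

theorem isCP_id {n : Type} : IsCP (LinearMap.id : SuperOp n n) := fun _ _ hX => hX

theorem IsCP.comp {n m l : Type} {Φ : SuperOp m l} {Ψ : SuperOp n m} (hΦ : IsCP Φ)
    (hΨ : IsCP Ψ) : IsCP (Φ ∘ₗ Ψ) := fun k X hX => hΦ k _ (hΨ k X hX)

/-- The Choi matrix of a completely positive map is positive semidefinite. -/
theorem IsCP.posSemidef_choi {d : ℕ} {m : Type} {Φ : SuperOp (Fin d) m} (hΦ : IsCP Φ) :
    (Matrix.of fun p q : Fin d × m => Φ (Matrix.single p.1 q.1 1) p.2 q.2).PosSemidef := by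
  have h := hΦ d _ (Matrix.posSemidef_vecMulVec_self_star
    (fun p : Fin d × Fin d => if p.1 = p.2 then (1 : ℂ) else 0))
  refine (congrArg Matrix.PosSemidef ?_).mpr h
  ext p q
  change _ = Φ (Matrix.of fun i j => _) p.2 q.2
  refine congrArg (fun M : Matrix (Fin d) (Fin d) ℂ => Φ M p.2 q.2) ?_
  ext i j
  simp only [Matrix.vecMulVec_apply, Matrix.of_apply, Matrix.single_apply, Pi.star_apply]
  by_cases h1 : p.1 = i <;> by_cases h2 : q.1 = j <;> simp [h1, h2]

theorem norm_sq_le_of_posSemidef {n : Type} {C : Matrix n n ℂ} (hC : C.PosSemidef) (x y : n) :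
    ‖C x y‖ ^ 2 ≤ (C x x).re * (C y y).re := by
  have h := (hC.submatrix ![x, y]).det_nonneg
  rw [Matrix.det_fin_two] at h
  simp only [Matrix.submatrix_apply, Matrix.cons_val_zero, Matrix.cons_val_one] at h
  have h1 : C y x = star (C x y) := (hC.isHermitian.apply y x).symm
  have hx := Complex.nonneg_iff.1 (hC.diag_nonneg (i := x))
  have hy := Complex.nonneg_iff.1 (hC.diag_nonneg (i := y))
  have h2 : C x y * C y x = ((‖C x y‖ ^ 2 : ℝ) : ℂ) := by
    rw [h1, Complex.star_def, Complex.mul_conj, Complex.normSq_eq_norm_sq]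
  rw [h2] at h
  have h3 := (Complex.nonneg_iff.1 h).1
  rw [Complex.sub_re, Complex.ofReal_re, Complex.mul_re, ← hx.2, zero_mul, sub_zero] at h3
  linarith

/-- The diagonal entries `tr Φ(|i⟩⟨i|)` of the effect `Φ†(1)` of a completely positive map. -/
def effectDiag {n m : Type} [DecidableEq n] [Fintype m] (Φ : SuperOp n m) (i : n) : ℝ :=
  (Φ (Matrix.single i i 1)).trace.re

theorem IsCP.diag_nonneg {d : ℕ} {m : Type} {Φ : SuperOp (Fin d) m}
    (hΦ : IsCP Φ) (i : Fin d) (k : m) : 0 ≤ Φ (Matrix.single i i 1) k k :=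
  hΦ.posSemidef_choi.diag_nonneg (i := (i, k))

theorem IsCP.diag_le_effectDiag {d : ℕ} {m : Type} [Fintype m] {Φ : SuperOp (Fin d) m}
    (hΦ : IsCP Φ) (i : Fin d) (k : m) : (Φ (Matrix.single i i 1) k k).re ≤ effectDiag Φ i := by
  rw [effectDiag, Matrix.trace, Complex.re_sum]
  exact Finset.single_le_sum
    (f := fun k => (Φ (Matrix.single i i 1) k k).re)
    (fun k _ => (Complex.nonneg_iff.1 (hΦ.diag_nonneg i k)).1) (Finset.mem_univ k)

theorem IsCP.effectDiag_nonneg {d : ℕ} {m : Type} [Fintype m] {Φ : SuperOp (Fin d) m}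
    (hΦ : IsCP Φ) (i : Fin d) : 0 ≤ effectDiag Φ i := by
  rw [effectDiag, Matrix.trace, Complex.re_sum]
  exact Finset.sum_nonneg fun k _ => (Complex.nonneg_iff.1 (hΦ.diag_nonneg i k)).1

theorem IsCP.norm_apply_single_le {d : ℕ} {m : Type} [Fintype m] {Φ : SuperOp (Fin d) m}
    (hΦ : IsCP Φ) (i j : Fin d) (k l : m) :
    ‖Φ (Matrix.single i j 1) k l‖ ≤ √(effectDiag Φ i * effectDiag Φ j) := by
  apply Real.le_sqrt_of_sq_le
  have h := norm_sq_le_of_posSemidef hΦ.posSemidef_choi (i, k) (j, l)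
  simp only [Matrix.of_apply] at h
  exact h.trans (mul_le_mul (hΦ.diag_le_effectDiag i k) (hΦ.diag_le_effectDiag j l)
    (Complex.nonneg_iff.1 (hΦ.diag_nonneg j l)).1 (hΦ.effectDiag_nonneg i))

theorem superOp_prod_ext {n k l : Type} [Fintype n] [DecidableEq n] [Fintype k] [DecidableEq k]
    {Φ Ψ : SuperOp (n × k) l}
    (h : ∀ (X : Matrix n n ℂ) (Y : Matrix k k ℂ), Φ (X ⊗ₖ Y) = Ψ (X ⊗ₖ Y)) : Φ = Ψ := by
  apply Matrix.ext_linearMap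
  rintro ⟨i, a⟩ ⟨j, b⟩
  ext1
  have := h (Matrix.single i j 1) (Matrix.single a b 1)
  rw [Matrix.single_kronecker_single, mul_one] at this
  exact this

theorem tensor_comp_tensor {n k : Type} [Fintype n] [DecidableEq n] [Fintype k] [DecidableEq k]
    (Φ Φ' : SuperOp n n) (Ψ Ψ' : SuperOp k k) :
    tensor Φ Ψ ∘ₗ tensor Φ' Ψ' = tensor (Φ ∘ₗ Φ') (Ψ ∘ₗ Ψ') :=
  superOp_prod_ext fun X Y => by
    simp only [LinearMap.comp_apply, tensor_kronecker]

/-! ### Monotones of product decompositions -/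

/-- Nonnegative functions of the diagonals `(p, m)` and `(q, n)` of two qubit effects that are
superadditive in either pair. Under a local instrument of one party, the sum of the values over the
outcomes does not exceed the initial value. -/
structure IsMonotone (w : ℝ → ℝ → ℝ → ℝ → ℝ) : Prop where
  nonneg : ∀ {p m q n : ℝ}, 0 ≤ p → 0 ≤ m → 0 ≤ q → 0 ≤ n → 0 ≤ w p m q n
  left : ∀ {p m p' m' q n : ℝ}, 0 ≤ p → 0 ≤ m → 0 ≤ p' → 0 ≤ m' → 0 ≤ q → 0 ≤ n →
    w p m q n + w p' m' q n ≤ w (p + p') (m + m') q n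
  right : ∀ {p m q n q' n' : ℝ}, 0 ≤ p → 0 ≤ m → 0 ≤ q → 0 ≤ n → 0 ≤ q' → 0 ≤ n' →
    w p m q n + w p m q' n' ≤ w p m (q + q') (n + n')

theorem isMonotone_potential : IsMonotone potential where
  nonneg := potential_nonneg
  left := potential_superadditive
  right hp hm hq hn hq' hn' := by
    rw [potential_comm _ _ (_ + _), potential_comm _ _ _ _, add_comm, potential_comm _ _ _ _,
      add_comm]
    exact potential_superadditive hq hn hq' hn' hp hm

/-- The total weight `tr E†(1) · tr F†(1)`, which is additive. -/
theorem isMonotone_totalWeight : IsMonotone fun p m q n => (p + m) * (q + n) where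
  nonneg _ _ _ _ := by positivity
  left _ _ _ _ _ _ := by apply le_of_eq; ring
  right _ _ _ _ _ _ := by apply le_of_eq; ring

theorem IsMonotone.swap {w : ℝ → ℝ → ℝ → ℝ → ℝ} (hw : IsMonotone w) :
    IsMonotone fun p m q n => w q n p m where
  nonneg hp hm hq hn := hw.nonneg hq hn hp hm
  left hp hm hp' hm' hq hn := hw.right hq hn hp hm hp' hm'
  right hp hm hq hn hq' hn' := hw.left hq hn hq' hn' hp hm

theorem IsMonotone.sum_le {w : ℝ → ℝ → ℝ → ℝ → ℝ} (hw : IsMonotone w) {ι : Type} (s : Finset ι)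
    {p m : ι → ℝ} (hp : ∀ i, 0 ≤ p i) (hm : ∀ i, 0 ≤ m i) {q n : ℝ} (hq : 0 ≤ q) (hn : 0 ≤ n) :
    ∑ i ∈ s, w (p i) (m i) q n ≤ w (∑ i ∈ s, p i) (∑ i ∈ s, m i) q n := by
  classical
  induction s using Finset.induction_on with
  | empty => simpa using hw.nonneg le_rfl le_rfl hq hn
  | insert a s ha ih =>
    rw [Finset.sum_insert ha, Finset.sum_insert ha, Finset.sum_insert ha]
    have := hw.left (hp a) (hm a) (Finset.sum_nonneg fun i (_ : i ∈ s) => hp i)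
      (Finset.sum_nonneg fun i (_ : i ∈ s) => hm i) hq hn
    linarith

theorem IsMonotone.tsum_le {w : ℝ → ℝ → ℝ → ℝ → ℝ} (hw : IsMonotone w) {ι : Type}
    {p m : ι → ℝ} (hp : ∀ i, 0 ≤ p i) (hm : ∀ i, 0 ≤ m i) {q n : ℝ} (hq : 0 ≤ q) (hn : 0 ≤ n)
    {P M : ℝ} (hP : HasSum p P) (hM : HasSum m M) :
    ∑' i, ENNReal.ofReal (w (p i) (m i) q n) ≤ ENNReal.ofReal (w P M q n) := by
  refine ENNReal.summable.tsum_le_of_sum_le fun s => ?_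
  rw [← ENNReal.ofReal_sum_of_nonneg fun i _ => hw.nonneg (hp i) (hm i) hq hn]
  apply ENNReal.ofReal_le_ofReal
  refine (hw.sum_le s hp hm hq hn).trans ?_
  have h1 := Finset.sum_nonneg fun i (_ : i ∈ s) => hp i
  have h2 := Finset.sum_nonneg fun i (_ : i ∈ s) => hm i
  have h3 : 0 ≤ P - ∑ i ∈ s, p i := sub_nonneg.2 (sum_le_hasSum s (fun i _ => hp i) hP)
  have h4 : 0 ≤ M - ∑ i ∈ s, m i := sub_nonneg.2 (sum_le_hasSum s (fun i _ => hm i) hM)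
  have := hw.left h1 h2 h3 h4 hq hn
  rw [add_sub_cancel, add_sub_cancel] at this
  linarith [hw.nonneg h3 h4 hq hn]

/-- The value of `w` at the product map `E ⊗ F`. -/
def pairValue (w : ℝ → ℝ → ℝ → ℝ → ℝ) (E F : SuperOp (Fin 2) (Fin 2)) : ℝ :=
  w (effectDiag E 0) (effectDiag E 1) (effectDiag F 0) (effectDiag F 1)

/-- Families of superoperators each of which is a sum of products of completely positive maps, such
that no monotone has increased in total from its value at the identity map. -/
def IsMonotoneDecomposable {Θ : Type} (J : Family Θ (Fin 2 × Fin 2)) : Prop :=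
  ∃ (I : Θ → Type) (E F : ∀ θ, I θ → SuperOp (Fin 2) (Fin 2)),
    (∀ θ i, IsCP (E θ i)) ∧ (∀ θ i, IsCP (F θ i)) ∧
    (∀ θ X, HasSum (fun i => tensor (E θ i) (F θ i) X) (J θ X)) ∧
    ∀ w, IsMonotone w →
      ∑' (θ) (i), ENNReal.ofReal (pairValue w (E θ i) (F θ i)) ≤ ENNReal.ofReal (w 1 1 1 1)

theorem effectDiag_id (i : Fin 2) :
    effectDiag (LinearMap.id : SuperOp (Fin 2) (Fin 2)) i = 1 := by
  simp [effectDiag, Matrix.trace_single_eq_same]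

theorem isMonotoneDecomposable_id :
    IsMonotoneDecomposable fun _ : Unit => (LinearMap.id : SuperOp (Fin 2 × Fin 2) _) := by
  refine ⟨fun _ => Unit, fun _ _ => LinearMap.id, fun _ _ => LinearMap.id, fun _ _ => isCP_id,
    fun _ _ => isCP_id, fun _ X => ?_, fun w _ => ?_⟩
  · exact hasSum_unique (fun _ : Unit => X)
  · simp [pairValue, effectDiag_id]

theorem sqrt_mul_le_add {a b : ℝ} (ha : 0 ≤ a) (hb : 0 ≤ b) : √(a * b) ≤ a + b := by
  apply Real.sqrt_le_iff.2 ⟨by positivity, _⟩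
  nlinarith [mul_nonneg ha hb, sq_nonneg a, sq_nonneg b]

theorem IsCP.norm_apply_single_le_add {Φ : SuperOp (Fin 2) (Fin 2)} (hΦ : IsCP Φ)
    (i j k l : Fin 2) :
    ‖Φ (Matrix.single i j 1) k l‖ ≤ 2 * (effectDiag Φ 0 + effectDiag Φ 1) := by
  refine (hΦ.norm_apply_single_le i j k l).trans ((sqrt_mul_le_add (hΦ.effectDiag_nonneg i)
    (hΦ.effectDiag_nonneg j)).trans ?_)
  have h0 := hΦ.effectDiag_nonneg 0
  have h1 := hΦ.effectDiag_nonneg 1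
  fin_cases i <;> fin_cases j <;> simp <;> linarith

theorem norm_tensor_apply_le {E F : SuperOp (Fin 2) (Fin 2)} (hE : IsCP E) (hF : IsCP F)
    (X : Matrix (Fin 2 × Fin 2) (Fin 2 × Fin 2) ℂ) (a b : Fin 2 × Fin 2) :
    ‖tensor E F X a b‖ ≤ (4 * ∑ i, ∑ j, ‖X i j‖) *
      pairValue (fun p m q n => (p + m) * (q + n)) E F := by
  conv_lhs => rw [Matrix.matrix_eq_sum_single X]
  simp only [map_sum, Matrix.sum_apply]
  refine (norm_sum_le _ _).trans ?_
  rw [Finset.mul_sum, Finset.sum_mul]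
  refine Finset.sum_le_sum fun i _ => ?_
  refine (norm_sum_le _ _).trans ?_
  rw [Finset.mul_sum, Finset.sum_mul]
  refine Finset.sum_le_sum fun j _ => ?_
  have : Matrix.single i j (X i j) =
      X i j • (Matrix.single i.1 j.1 (1 : ℂ) ⊗ₖ Matrix.single i.2 j.2 (1 : ℂ)) := by
    rw [Matrix.single_kronecker_single, Matrix.smul_single, mul_one, smul_eq_mul, mul_one]
  rw [this, map_smul, tensor_kronecker, Matrix.smul_apply, norm_smul, Matrix.kronecker_apply,
    norm_mul]
  have hp := add_nonneg (hE.effectDiag_nonneg 0) (hE.effectDiag_nonneg 1)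
  have := mul_le_mul (hE.norm_apply_single_le_add i.1 j.1 a.1 b.1)
    (hF.norm_apply_single_le_add i.2 j.2 a.2 b.2) (norm_nonneg _) (by positivity)
  have := mul_le_mul_of_nonneg_left this (norm_nonneg (X i j))
  refine this.trans (le_of_eq ?_)
  simp only [pairValue]
  ring

/-- The product maps of a coarse-graining are those of the fine-grained family, regrouped. The total
weight makes the regrouped sums summable. -/
theorem IsMonotoneDecomposable.coarseGraining {Θ Θ' : Type} {J : Family Θ (Fin 2 × Fin 2)}
    {J' : Family Θ' (Fin 2 × Fin 2)} (hJ : IsMonotoneDecomposable J)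
    (h : IsCoarseGraining J' J) : IsMonotoneDecomposable J' := by
  obtain ⟨I, E, F, hE, hF, hs, hw⟩ := hJ
  obtain ⟨f, hf⟩ := h
  have hw' : ∀ w, IsMonotone w →
      ∑' (k : Θ') (x : Σ j : {j // f j = k}, I j),
        ENNReal.ofReal (pairValue w (E x.1 x.2) (F x.1 x.2)) ≤ ENNReal.ofReal (w 1 1 1 1) := by
    intro w hmw
    refine le_trans (le_of_eq ?_) (hw w hmw)
    rw [← (Equiv.sigmaFiberEquiv f).tsum_eq, ENNReal.tsum_sigma']
    refine tsum_congr fun k => ?_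
    rw [ENNReal.tsum_sigma']
    rfl
  refine ⟨fun k => Σ j : {j // f j = k}, I j, fun k x => E x.1 x.2, fun k x => F x.1 x.2,
    fun k x => hE _ _, fun k x => hF _ _, fun k X => ?_, hw'⟩
  refine HasSum.sigma_of_hasSum (hf k X) (fun j => hs j X) ?_
  have hfin : ∑' (x : Σ j : {j // f j = k}, I j), ENNReal.ofReal
      (pairValue (fun p m q n => (p + m) * (q + n)) (E x.1 x.2) (F x.1 x.2)) ≠ ⊤ := by
    refine ne_top_of_le_ne_top ENNReal.ofReal_ne_top
      ((ENNReal.le_tsum k).trans (hw' _ isMonotone_totalWeight))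
  have hsum := (ENNReal.summable_toReal hfin).mul_left (4 * ∑ i, ∑ j, ‖X i j‖)
  refine Pi.summable.2 fun a => Pi.summable.2 fun b => Summable.of_norm_bounded hsum fun x => ?_
  refine (norm_tensor_apply_le (hE _ _) (hF _ _) X a b).trans (le_of_eq ?_)
  rw [ENNReal.toReal_ofReal]
  exact isMonotone_totalWeight.nonneg ((hE _ _).effectDiag_nonneg _)
    ((hE _ _).effectDiag_nonneg _) ((hF _ _).effectDiag_nonneg _) ((hF _ _).effectDiag_nonneg _)

theorem IsInstrument.hasSum_trace {Ξ n : Type} [Fintype n] {B : Family Ξ n} (hB : IsInstrument B)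
    (X : Matrix n n ℂ) : HasSum (fun y => (B y X).trace) X.trace := by
  obtain ⟨-, -, T, hT, hs⟩ := hB
  rw [← hT X]
  exact (hs X).map (Matrix.traceAddMonoidHom n ℂ) (Continuous.matrix_trace continuous_id)

theorem effectDiag_comp_of_isTP {T F : SuperOp (Fin 2) (Fin 2)} (hT : IsTP T) (i : Fin 2) :
    effectDiag (T ∘ₗ F) i = effectDiag F i := by
  simp only [effectDiag, LinearMap.comp_apply, hT _]

/-- One-way local instruments are families of product maps, and applying them after a product map
does not increase any monotone in total: only the effect of the acting party is split. -/
theorem IsOneWayLocal.exists_tensor {Ξ : Type} {K : Party} {B : Family Ξ (Fin 2 × Fin 2)}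
    (h : IsOneWayLocal K B) :
    ∃ G H : Ξ → SuperOp (Fin 2) (Fin 2), (∀ y, IsCP (G y)) ∧ (∀ y, IsCP (H y)) ∧
      (∀ y, B y = tensor (G y) (H y)) ∧
      ∀ E F, IsCP E → IsCP F → ∀ w, IsMonotone w →
        ∑' y, ENNReal.ofReal (pairValue w (G y ∘ₗ E) (H y ∘ₗ F)) ≤
          ENNReal.ofReal (pairValue w E F) := by
  obtain ⟨hB, hK⟩ := h
  have hone : (Matrix.single (0 : Fin 2) (0 : Fin 2) (1 : ℂ)).trace = 1 :=
    Matrix.trace_single_eq_same _ _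
  cases K with
  | alice =>
    choose G H hG hH hT hGH using hK
    refine ⟨G, H, hG, hH, hGH, fun E F hE hF w hw => ?_⟩
    have hsum : ∀ i, HasSum (fun y => effectDiag (G y ∘ₗ E) i) (effectDiag E i) := fun i => by
      have := hB.hasSum_trace (E (Matrix.single i i 1) ⊗ₖ Matrix.single 0 0 1)
      simp only [hGH, tensor_kronecker, Matrix.trace_kronecker, hT _ _, hone, mul_one] at this
      exact Complex.hasSum_re this
    simp only [pairValue, effectDiag_comp_of_isTP (hT _)]
    exact hw.tsum_le (fun y => ((hG y).comp hE).effectDiag_nonneg _)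
      (fun y => ((hG y).comp hE).effectDiag_nonneg _) (hF.effectDiag_nonneg _)
      (hF.effectDiag_nonneg _) (hsum 0) (hsum 1)
  | bob =>
    choose G H hG hT hH hGH using hK
    refine ⟨G, H, hG, hH, hGH, fun E F hE hF w hw => ?_⟩
    have hsum : ∀ i, HasSum (fun y => effectDiag (H y ∘ₗ F) i) (effectDiag F i) := fun i => by
      have := hB.hasSum_trace (Matrix.single 0 0 1 ⊗ₖ F (Matrix.single i i 1))
      simp only [hGH, tensor_kronecker, Matrix.trace_kronecker, hT _ _, hone, one_mul] at this
      exact Complex.hasSum_re this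
    simp only [pairValue, effectDiag_comp_of_isTP (hT _)]
    exact hw.swap.tsum_le (fun y => ((hH y).comp hF).effectDiag_nonneg _)
      (fun y => ((hH y).comp hF).effectDiag_nonneg _) (hE.effectDiag_nonneg _)
      (hE.effectDiag_nonneg _) (hsum 0) (hsum 1)

/-- Every product map in the decomposition of the outcome `j` is followed by the product maps of the
instrument that is applied after `j`. -/
theorem IsMonotoneDecomposable.linked {Θ Θ' : Type} {J : Family Θ (Fin 2 × Fin 2)}
    {J' : Family Θ' (Fin 2 × Fin 2)} (hJ : IsMonotoneDecomposable J)
    (h : IsLOCCLinked J' J) : IsMonotoneDecomposable J' := by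
  obtain ⟨K, Ξ, B, hB, hcg⟩ := h
  refine IsMonotoneDecomposable.coarseGraining ?_ hcg
  obtain ⟨I, E, F, hE, hF, hs, hw⟩ := hJ
  choose G H hG hH hGH hGHw using fun j => (hB j).exists_tensor
  refine ⟨fun x => I x.1, fun x i => G x.1 x.2 ∘ₗ E x.1 i, fun x i => H x.1 x.2 ∘ₗ F x.1 i,
    fun x i => (hG _ _).comp (hE _ _), fun x i => (hH _ _).comp (hF _ _), fun x X => ?_,
    fun w hmw => ?_⟩
  · simp only [← tensor_comp_tensor, ← hGH]
    exact (hs x.1 X).map (B x.1 x.2) (LinearMap.continuous_of_finiteDimensional _)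
  · refine le_trans ?_ (hw w hmw)
    rw [ENNReal.tsum_sigma']
    refine ENNReal.tsum_le_tsum fun j => ?_
    change ∑' (y : Ξ j) (i : I j),
      ENNReal.ofReal (pairValue w (G j y ∘ₗ E j i) (H j y ∘ₗ F j i)) ≤ _
    rw [ENNReal.tsum_comm]
    exact ENNReal.tsum_le_tsum fun i => hGHw j _ _ (hE _ _) (hF _ _) w hmw

theorem InLOCC.isMonotoneDecomposable {r : ℕ} {Θ : Type} {J : Family Θ (Fin 2 × Fin 2)}
    (h : InLOCC r J) : IsMonotoneDecomposable J := by
  induction h with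
  | one K J J' h hcg =>
    -- A one-way local instrument is the linking of itself to the identity.
    have : IsLOCCLinked J (fun _ : Unit => (LinearMap.id : SuperOp (Fin 2 × Fin 2) _)) := by
      refine ⟨fun _ => K, fun _ => _, fun _ => J, fun _ => h, Sigma.snd, fun k X => ?_⟩
      let _ : Unique {x : (_ : Unit) × _ // x.2 = k} :=
        ⟨⟨⟨⟨(), k⟩, rfl⟩⟩, by rintro ⟨⟨_, x⟩, rfl⟩; rfl⟩
      exact hasSum_unique _
    exact (isMonotoneDecomposable_id.linked this).coarseGraining hcg
  | succ r J J' _ h ih => exact ih.linked h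

/-! ### The coherence bound for LOCC -/

/-- The sum of the moduli of one coherence in either of the first two outcomes: that of `|10⟩⟨00|`
in the first and of `|01⟩⟨00|` in the second. -/
def coherence (J : Family (Fin 3) (Fin 2 × Fin 2)) : ℝ :=
  ‖J 0 (Matrix.single (1, 0) (0, 0) 1) (1, 0) (0, 0)‖ +
    ‖J 1 (Matrix.single (0, 1) (0, 0) 1) (0, 1) (0, 0)‖

theorem norm_tensor_left_le_potential {E F : SuperOp (Fin 2) (Fin 2)} (hE : IsCP E)
    (hF : IsCP F) :
    ‖tensor E F (Matrix.single (1, 0) (0, 0) 1) (1, 0) (0, 0)‖ ≤ pairValue potential E F := by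
  have : (Matrix.single (1, 0) (0, 0) 1 : Matrix (Fin 2 × Fin 2) (Fin 2 × Fin 2) ℂ) =
      Matrix.single 1 0 1 ⊗ₖ Matrix.single 0 0 1 := by
    rw [Matrix.single_kronecker_single, mul_one]
  rw [this, tensor_kronecker, Matrix.kronecker_apply, norm_mul]
  refine le_trans ?_ (mul_sqrt_le_potential (hE.effectDiag_nonneg 0) (hE.effectDiag_nonneg 1)
    (hF.effectDiag_nonneg 0) (hF.effectDiag_nonneg 1))
  refine mul_le_mul (hE.norm_apply_single_le 1 0 1 0) ?_ (norm_nonneg _) (Real.sqrt_nonneg _)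
  refine (hF.norm_apply_single_le 0 0 0 0).trans (le_of_eq ?_)
  exact Real.sqrt_mul_self (hF.effectDiag_nonneg 0)

theorem norm_tensor_right_le_potential {E F : SuperOp (Fin 2) (Fin 2)} (hE : IsCP E)
    (hF : IsCP F) :
    ‖tensor E F (Matrix.single (0, 1) (0, 0) 1) (0, 1) (0, 0)‖ ≤ pairValue potential E F := by
  have : (Matrix.single (0, 1) (0, 0) 1 : Matrix (Fin 2 × Fin 2) (Fin 2 × Fin 2) ℂ) =
      Matrix.single 0 0 1 ⊗ₖ Matrix.single 1 0 1 := by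
    rw [Matrix.single_kronecker_single, mul_one]
  rw [this, tensor_kronecker, Matrix.kronecker_apply, norm_mul, mul_comm, pairValue,
    potential_comm]
  refine le_trans ?_ (mul_sqrt_le_potential (hF.effectDiag_nonneg 0) (hF.effectDiag_nonneg 1)
    (hE.effectDiag_nonneg 0) (hE.effectDiag_nonneg 1))
  refine mul_le_mul (hF.norm_apply_single_le 1 0 1 0) ?_ (norm_nonneg _) (Real.sqrt_nonneg _)
  refine (hE.norm_apply_single_le 0 0 0 0).trans (le_of_eq ?_)
  exact Real.sqrt_mul_self (hE.effectDiag_nonneg 0)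

theorem ofReal_norm_le_tsum {ι : Type} {M : ι → Matrix (Fin 2 × Fin 2) (Fin 2 × Fin 2) ℂ}
    {S : Matrix (Fin 2 × Fin 2) (Fin 2 × Fin 2) ℂ} (hS : HasSum M S) {u : ι → ℝ}
    {a b : Fin 2 × Fin 2} (h : ∀ i, ‖M i a b‖ ≤ u i) :
    ENNReal.ofReal ‖S a b‖ ≤ ∑' i, ENNReal.ofReal (u i) := by
  have hab : HasSum (fun i => M i a b) (S a b) := Pi.hasSum.1 (Pi.hasSum.1 hS a) b
  rw [← hab.tsum_eq, ofReal_norm]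
  refine enorm_tsum_le_tsum_enorm.trans (ENNReal.tsum_le_tsum fun i => ?_)
  rw [← ofReal_norm]
  exact ENNReal.ofReal_le_ofReal (h i)

theorem IsMonotoneDecomposable.coherence_le {J : Family (Fin 3) (Fin 2 × Fin 2)}
    (hJ : IsMonotoneDecomposable J) : coherence J ≤ 4 / 3 := by
  obtain ⟨I, E, F, hE, hF, hs, hw⟩ := hJ
  have h := hw _ isMonotone_potential
  rw [tsum_fintype, Fin.sum_univ_three, potential_one] at h
  have h0 := ofReal_norm_le_tsum (hs 0 (Matrix.single (1, 0) (0, 0) 1))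
    fun i => norm_tensor_left_le_potential (hE 0 i) (hF 0 i)
  have h1 := ofReal_norm_le_tsum (hs 1 (Matrix.single (0, 1) (0, 0) 1))
    fun i => norm_tensor_right_le_potential (hE 1 i) (hF 1 i)
  rw [coherence, ← ENNReal.ofReal_le_ofReal_iff (by norm_num),
    ENNReal.ofReal_add (norm_nonneg _) (norm_nonneg _)]
  exact ((add_le_add h0 h1).trans le_self_add).trans h

/-! ### Convergence in the diamond distance -/

theorem sum_eigenvalues_conjTranspose_mul_self {n : Type} [Fintype n] [DecidableEq n]
    (X : Matrix n n ℂ) :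
    ∑ i, (Matrix.isHermitian_conjTranspose_mul_self X).eigenvalues i = ∑ i, ∑ j, ‖X i j‖ ^ 2 := by
  have h := (Matrix.isHermitian_conjTranspose_mul_self X).trace_eq_sum_eigenvalues
  have h2 : (X.conjTranspose * X).trace = ((∑ i, ∑ j, ‖X i j‖ ^ 2 : ℝ) : ℂ) := by
    rw [Finset.sum_comm]
    simp only [Matrix.trace, Matrix.diag_apply, Matrix.mul_apply, Matrix.conjTranspose_apply]
    push_cast
    refine Finset.sum_congr rfl fun j _ => Finset.sum_congr rfl fun i _ => ?_
    rw [Complex.star_def, Complex.conj_mul']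
  rw [h2] at h
  refine Complex.ofReal_injective ?_
  rw [h, Complex.ofReal_sum]
  rfl

theorem norm_apply_le_traceNorm {n : Type} [Fintype n] [DecidableEq n] (X : Matrix n n ℂ)
    (a b : n) : ‖X a b‖ ≤ traceNorm X := by
  have hX := Matrix.isHermitian_conjTranspose_mul_self X
  have hnn := (Matrix.posSemidef_conjTranspose_mul_self X).eigenvalues_nonneg
  have h0 : 0 ≤ traceNorm X := Finset.sum_nonneg fun i _ => Real.sqrt_nonneg _
  refine abs_le_of_sq_le_sq' ?_ h0 |>.2
  calc ‖X a b‖ ^ 2 ≤ ∑ j, ‖X a j‖ ^ 2 :=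
        Finset.single_le_sum (f := fun j => ‖X a j‖ ^ 2) (fun j _ => by positivity)
          (Finset.mem_univ b)
    _ ≤ ∑ i, ∑ j, ‖X i j‖ ^ 2 :=
        Finset.single_le_sum (f := fun i => ∑ j, ‖X i j‖ ^ 2)
          (fun i _ => Finset.sum_nonneg fun j _ => by positivity) (Finset.mem_univ a)
    _ = ∑ i, √(hX.eigenvalues i) ^ 2 := by
        rw [← sum_eigenvalues_conjTranspose_mul_self]
        exact Finset.sum_congr rfl fun i _ => (Real.sq_sqrt (hnn i)).symm
    _ ≤ traceNorm X ^ 2 := Finset.sum_sq_le_sq_sum_of_nonneg fun i _ => Real.sqrt_nonneg _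

theorem traceNorm_le {n : Type} [Fintype n] [DecidableEq n] (X : Matrix n n ℂ) :
    traceNorm X ≤ Fintype.card n * √(∑ i, ∑ j, ‖X i j‖ ^ 2) := by
  rw [← sum_eigenvalues_conjTranspose_mul_self, ← nsmul_eq_mul]
  refine Finset.sum_le_card_nsmul _ _ _ fun i _ => Real.sqrt_le_sqrt ?_
  exact Finset.single_le_sum
    (f := fun i => (Matrix.isHermitian_conjTranspose_mul_self X).eigenvalues i)
    (fun i _ => (Matrix.posSemidef_conjTranspose_mul_self X).eigenvalues_nonneg i)
    (Finset.mem_univ i)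

/-- Every matrix can be scaled to be an admissible input in the diamond norm. -/
theorem exists_smul_traceNorm_le_one {n : Type} [Fintype n] [DecidableEq n] (X : Matrix n n ℂ) :
    ∃ c : ℝ, 0 < c ∧ traceNorm ((c : ℂ) • X) ≤ 1 := by
  set s := √(∑ i, ∑ j, ‖X i j‖ ^ 2) with hs
  have hs0 : 0 ≤ s := Real.sqrt_nonneg _
  have hpos : 0 < Fintype.card n * s + 1 := by positivity
  refine ⟨(Fintype.card n * s + 1)⁻¹, by positivity, (traceNorm_le _).trans ?_⟩
  set c := (Fintype.card n * s + 1)⁻¹ with hc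
  have hc0 : 0 ≤ c := by positivity
  have : √(∑ i, ∑ j, ‖((c : ℂ) • X) i j‖ ^ 2) = c * s := by
    simp only [Matrix.smul_apply, norm_smul, mul_pow, ← Finset.mul_sum, Complex.norm_real,
      Real.norm_eq_abs, sq_abs]
    rw [Real.sqrt_mul (sq_nonneg c), Real.sqrt_sq hc0]
  rw [this, hc]
  field_simp
  linarith

/-- The diamond norm without auxiliary system bounds the entries of the output. -/
theorem ofReal_norm_apply_le_diamondNorm {n m : Type} [Fintype n] [DecidableEq n] [Fintype m]
    [DecidableEq m] (X : Matrix n n ℂ) :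
    ∃ c : ℝ, 0 < c ∧ ∀ (Φ : SuperOp n m) (a b : m),
      ENNReal.ofReal (c * ‖Φ X a b‖) ≤ diamondNorm Φ := by
  obtain ⟨c, hc, h⟩ := exists_smul_traceNorm_le_one
    (Matrix.of fun p q : Fin 1 × n => X p.2 q.2)
  refine ⟨c, hc, fun Φ a b => ?_⟩
  refine le_trans (ENNReal.ofReal_le_ofReal ?_) (le_iSup_of_le 1 (le_iSup_of_le _
    (le_iSup_of_le h le_rfl)))
  refine le_trans (le_of_eq ?_) (norm_apply_le_traceNorm _ (0, a) (0, b))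
  have : idTensor (Fin 1) Φ ((c : ℂ) • Matrix.of fun p q : Fin 1 × n => X p.2 q.2) (0, a) (0, b) =
      Φ ((c : ℂ) • X) a b := rfl
  rw [this, map_smul, Matrix.smul_apply, norm_smul, Complex.norm_real, Real.norm_of_nonneg hc.le]

theorem ConvergesTo.tendsto_apply {Θ n : Type} [Fintype Θ] [DecidableEq Θ] [Fintype n]
    [DecidableEq n] {Js : ℕ → Family Θ n} {J : Family Θ n} (h : ConvergesTo Js J) (j : Θ)
    (X : Matrix n n ℂ) (a b : n) :
    Tendsto (fun ν => Js ν j X a b) atTop (𝓝 (J j X a b)) := by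
  obtain ⟨c, hc, H⟩ := ofReal_norm_apply_le_diamondNorm (m := n × Θ) X
  rw [tendsto_iff_norm_sub_tendsto_zero]
  have h1 : Tendsto (fun ν => ENNReal.ofReal (c * ‖Js ν j X a b - J j X a b‖)) atTop (𝓝 0) := by
    refine tendsto_of_tendsto_of_tendsto_of_le_of_le tendsto_const_nhds h (fun _ => zero_le)
      fun ν => ?_
    refine le_trans (le_of_eq ?_) (H (toChannel (Js ν) - toChannel J) (a, j) (b, j))
    congr 3
    change _ = Matrix.blockDiagonal (fun j => Js ν j X) (a, j) (b, j) -
      Matrix.blockDiagonal (fun j => J j X) (a, j) (b, j)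
    rw [Matrix.blockDiagonal_apply_eq, Matrix.blockDiagonal_apply_eq]
  have h2 := (ENNReal.tendsto_toReal ENNReal.zero_ne_top).comp h1
  have h3 := h2.const_mul c⁻¹
  simp only [ENNReal.toReal_zero, mul_zero] at h3
  refine h3.congr fun ν => ?_
  rw [Function.comp_apply, ENNReal.toReal_ofReal (by positivity), inv_mul_cancel_left₀ hc.ne']

/-! ### Product Kraus operators are separable -/

theorem idTensor_krausMap {k n : Type} [Fintype k] [DecidableEq k] [Fintype n]
    (M : Matrix n n ℂ) (X : Matrix (k × n) (k × n) ℂ) :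
    idTensor k (krausMap M) X =
      ((1 : Matrix k k ℂ) ⊗ₖ M) * X * ((1 : Matrix k k ℂ) ⊗ₖ M).conjTranspose := by
  ext ⟨p, i⟩ ⟨q, j⟩
  change (M * (Matrix.of fun i j => X (p, i) (q, j)) * M.conjTranspose) i j = _
  simp [Matrix.mul_apply, Fintype.sum_prod_type, Matrix.one_apply, ite_mul, mul_ite,
    apply_ite (starRingEnd ℂ)]

theorem isCP_krausMap {n : Type} [Fintype n] (M : Matrix n n ℂ) : IsCP (krausMap M) :=
  fun k X hX => by
    rw [idTensor_krausMap]
    exact hX.mul_mul_conjTranspose_same _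

theorem krausMap_kronecker {n m : Type} [Fintype n] [Fintype m] (K P : Matrix n n ℂ)
    (L Q : Matrix m m ℂ) : krausMap (K ⊗ₖ L) (P ⊗ₖ Q) = krausMap K P ⊗ₖ krausMap L Q := by
  change (K ⊗ₖ L) * (P ⊗ₖ Q) * (K ⊗ₖ L).conjTranspose = _
  rw [Matrix.conjTranspose_kronecker, ← Matrix.mul_kronecker_mul, ← Matrix.mul_kronecker_mul]
  rfl

theorem exists_smul_density {n : Type} [Fintype n] {P : Matrix n n ℂ} (hP : P.PosSemidef) :
    P = 0 ∨ ∃ t : ℝ, 0 ≤ t ∧ ∃ α, IsDensity α ∧ P = t • α := by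
  rcases eq_or_ne P.trace 0 with h | h
  · exact Or.inl (hP.trace_eq_zero_iff.1 h)
  · right
    obtain ⟨h1, h2⟩ := Complex.nonneg_iff.1 hP.trace_nonneg
    have ht : P.trace = (P.trace.re : ℂ) := Complex.ext rfl (by simpa using h2.symm)
    have hne : P.trace.re ≠ 0 := fun h0 => h (by rw [ht, h0, Complex.ofReal_zero])
    refine ⟨P.trace.re, h1, P.trace.re⁻¹ • P, ⟨hP.smul (inv_nonneg.2 h1), ?_⟩, ?_⟩
    · rw [Matrix.trace_smul, Complex.real_smul, Complex.ofReal_inv, ← ht, inv_mul_cancel₀ h]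
    · rw [smul_smul, mul_inv_cancel₀ hne, one_smul]

/-- Nonemptiness of the set of separable states is needed for `P ⊗ Q = 0` only. -/
theorem kronecker_mem_cone {n m : Type} [Fintype n] [Fintype m] {P : Matrix n n ℂ}
    {Q : Matrix m m ℂ} (hP : P.PosSemidef) (hQ : Q.PosSemidef)
    (hne : (separableStates n m).Nonempty) :
    ∃ t : ℝ, 0 ≤ t ∧ ∃ σ ∈ separableStates n m, P ⊗ₖ Q = t • σ := by
  obtain ⟨σ₀, hσ₀⟩ := hne
  rcases exists_smul_density hP with rfl | ⟨s, hs, α, hα, rfl⟩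
  · exact ⟨0, le_rfl, σ₀, hσ₀, by rw [Matrix.zero_kronecker, zero_smul]⟩
  rcases exists_smul_density hQ with rfl | ⟨t, ht, β, hβ, rfl⟩
  · exact ⟨0, le_rfl, σ₀, hσ₀, by rw [Matrix.kronecker_zero, zero_smul]⟩
  refine ⟨s * t, mul_nonneg hs ht, α ⊗ₖ β, subset_convexHull _ _ ⟨α, β, hα, hβ, rfl⟩, ?_⟩
  rw [Matrix.smul_kronecker, Matrix.kronecker_smul, smul_smul]

theorem isSeparableMap_krausMap_kronecker {A B : Type} [Fintype A] [Fintype B]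
    (K : Matrix A A ℂ) (L : Matrix B B ℂ) : IsSeparableMap (krausMap (K ⊗ₖ L)) := by
  intro a b ρ hρ
  have hne : (separableStates (Fin a × A) (Fin b × B)).Nonempty := ⟨ρ, hρ⟩
  let e := Equiv.prodProdProdComm (Fin a) A (Fin b) B
  let Λ : Matrix ((Fin a × A) × (Fin b × B)) _ ℂ →ₗ[ℂ] Matrix ((Fin a × A) × (Fin b × B)) _ ℂ :=
    (Matrix.reindexLinearEquiv ℂ ℂ e.symm e.symm).toLinearMap ∘ₗ
      idTensor (Fin a × Fin b) (krausMap (K ⊗ₖ L)) ∘ₗ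
        (Matrix.reindexLinearEquiv ℂ ℂ e e).toLinearMap
  suffices h : separableStates (Fin a × A) (Fin b × B) ⊆
      {ρ | ∃ t : ℝ, 0 ≤ t ∧ ∃ σ ∈ separableStates (Fin a × A) (Fin b × B), Λ ρ = t • σ} from h hρ
  refine convexHull_min ?_ ?_
  · rintro _ ⟨α, β, hα, hβ, rfl⟩
    have hΛ : Λ (α ⊗ₖ β) =
        idTensor (Fin a) (krausMap K) α ⊗ₖ idTensor (Fin b) (krausMap L) β := by
      ext ⟨⟨a₁, i₁⟩, ⟨b₁, j₁⟩⟩ ⟨⟨a₂, i₂⟩, ⟨b₂, j₂⟩⟩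
      exact congrFun (congrFun (krausMap_kronecker K (Matrix.of fun i j => α (a₁, i) (a₂, j))
        L (Matrix.of fun i j => β (b₁, i) (b₂, j))) (i₁, j₁)) (i₂, j₂)
    obtain ⟨t, ht, σ, hσ, h⟩ := kronecker_mem_cone (isCP_krausMap K a α hα.1)
      (isCP_krausMap L b β hβ.1) hne
    exact ⟨t, ht, σ, hσ, hΛ.trans h⟩
  · rintro ρ₁ ⟨t₁, ht₁, σ₁, hσ₁, h₁⟩ ρ₂ ⟨t₂, ht₂, σ₂, hσ₂, h₂⟩ c₁ c₂ hc₁ hc₂ -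
    obtain ⟨σ, hσ, h⟩ := (convex_convexHull ℝ _).exists_mem_add_smul_eq hσ₁ hσ₂
      (mul_nonneg hc₁ ht₁) (mul_nonneg hc₂ ht₂)
    refine ⟨c₁ * t₁ + c₂ * t₂, by positivity, σ, hσ, ?_⟩
    rw [h, map_add, Λ.map_smul_of_tower, Λ.map_smul_of_tower, h₁, h₂, smul_smul, smul_smul]

/-! ### The three-outcome instrument -/

/-- The diagonals of the Kraus operators, which are diagonal in the product basis. -/
def krausDiag : Fin 3 → Fin 2 × Fin 2 → ℂ :=
  ![fun x => ![1 / (√2 : ℂ), 1] x.1 * ![1, 0] x.2, fun x => ![1, 0] x.1 * ![1 / (√2 : ℂ), 1] x.2,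
    fun x => ![0, 1] x.1 * ![0, 1] x.2]

theorem krausOp_eq_diagonal (i : Fin 3) : krausOp i = Matrix.diagonal (krausDiag i) := by
  have h0 : proj0 = Matrix.diagonal ![1, 0] := by
    ext i j; fin_cases i <;> fin_cases j <;> simp [proj0]
  have h1 : proj1 = Matrix.diagonal ![0, 1] := by
    ext i j; fin_cases i <;> fin_cases j <;> simp [proj1]
  have h2 : (1 / (√2 : ℂ)) • proj0 + proj1 = Matrix.diagonal ![1 / (√2 : ℂ), 1] := by
    ext i j; fin_cases i <;> fin_cases j <;> simp [proj0, proj1]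
  unfold krausOp
  rw [h2, h0, h1]
  fin_cases i <;> exact Matrix.diagonal_kronecker_diagonal _ _

theorem piInstrument_apply (i : Fin 3) (X : Matrix (Fin 2 × Fin 2) (Fin 2 × Fin 2) ℂ)
    (a b : Fin 2 × Fin 2) :
    piInstrument i X a b = krausDiag i a * X a b * star (krausDiag i b) := by
  change (krausOp i * X * (krausOp i).conjTranspose) a b = _
  rw [krausOp_eq_diagonal, Matrix.diagonal_conjTranspose, Matrix.mul_diagonal,
    Matrix.diagonal_mul]
  rfl

theorem sqrt_two_mul_self : (√2 : ℂ) * √2 = 2 := by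
  rw [← Complex.ofReal_mul, Real.mul_self_sqrt (by norm_num)]
  norm_num

theorem sqrt_two_ne_zero : (√2 : ℂ) ≠ 0 := by
  rw [Complex.ofReal_ne_zero]
  positivity

theorem sum_krausOp : ∑ i, (krausOp i).conjTranspose * krausOp i = 1 := by
  simp only [krausOp_eq_diagonal, Matrix.diagonal_conjTranspose, Matrix.diagonal_mul_diagonal,
    Fin.sum_univ_three, Matrix.diagonal_add, ← Matrix.diagonal_one]
  congr 1
  have h2 : (√2 : ℂ)⁻¹ * (√2 : ℂ)⁻¹ = 1 / 2 := by
    rw [← mul_inv, sqrt_two_mul_self, one_div]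
  funext ⟨a, b⟩
  fin_cases a <;> fin_cases b <;> simp [krausDiag, h2] <;> norm_num

theorem piInstrument_mem_SEP : piInstrument ∈ SEP (Fin 3) (Fin 2) (Fin 2) := by
  refine ⟨⟨inferInstance, fun j => isCP_krausMap _, ∑ j, piInstrument j, fun X => ?_,
    fun X => ?_⟩, fun j => ?_⟩
  · have : ∀ j, (piInstrument j X).trace = ((krausOp j).conjTranspose * krausOp j * X).trace :=
      fun j => by
        change (krausOp j * X * (krausOp j).conjTranspose).trace = _
        rw [Matrix.trace_mul_comm, Matrix.mul_assoc]
    rw [LinearMap.sum_apply, Matrix.trace_sum]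
    simp only [this]
    rw [← Matrix.trace_sum, ← Matrix.sum_mul, sum_krausOp, Matrix.one_mul]
  · rw [LinearMap.sum_apply]
    exact hasSum_fintype _
  · fin_cases j <;> exact isSeparableMap_krausMap_kronecker _ _

theorem coherence_piInstrument : coherence piInstrument = √2 := by
  have h2 : √2 * √2 = 2 := Real.mul_self_sqrt (by norm_num)
  have h0 : √2 ≠ 0 := by positivity
  simp only [coherence, piInstrument_apply]
  simp [krausDiag, abs_of_nonneg (Real.sqrt_nonneg 2)]
  field_simp
  linarith

theorem ConvergesTo.tendsto_coherence {Js : ℕ → Family (Fin 3) (Fin 2 × Fin 2)}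
    {J : Family (Fin 3) (Fin 2 × Fin 2)} (h : ConvergesTo Js J) :
    Tendsto (fun ν => coherence (Js ν)) atTop (𝓝 (coherence J)) :=
  (h.tendsto_apply 0 _ _ _).norm.add (h.tendsto_apply 1 _ _ _).norm

theorem coherence_le_of_mem_LOCCN {J : Family (Fin 3) (Fin 2 × Fin 2)}
    (hJ : J ∈ LOCCN (Fin 3) (Fin 2) (Fin 2)) : coherence J ≤ 4 / 3 := by
  obtain ⟨r, hr⟩ := hJ
  exact hr.isMonotoneDecomposable.coherence_le

theorem coherence_le_of_mem_LOCC {J : Family (Fin 3) (Fin 2 × Fin 2)}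
    (hJ : J ∈ LOCC (Fin 3) (Fin 2) (Fin 2)) : coherence J ≤ 4 / 3 := by
  obtain ⟨-, Ξ, Js, Js', hJs, -, hcg, hlim⟩ := hJ
  refine le_of_tendsto' hlim.tendsto_coherence fun ν => ?_
  obtain ⟨r, hr⟩ := hJs ν
  exact (hr.isMonotoneDecomposable.coarseGraining (hcg ν)).coherence_le

theorem piInstrument_notMem_closure {S : Set (Family (Fin 3) (Fin 2 × Fin 2))}
    (hS : ∀ J ∈ S, coherence J ≤ 4 / 3) : piInstrument ∉ instrClosure S := by
  rintro ⟨-, Js, hJs, hlim⟩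
  have h := le_of_tendsto' hlim.tendsto_coherence fun ν => hS _ (hJs ν)
  rw [coherence_piInstrument, Real.sqrt_le_left (by norm_num)] at h
  norm_num at h

/-! ### The concurrence of a pure state -/

theorem trace_pureState {n : Type} [Fintype n] (ψ : n → ℂ) :
    (pureState ψ).trace = ((∑ x, ‖ψ x‖ ^ 2 : ℝ) : ℂ) := by
  simp only [Matrix.trace, Matrix.diag_apply, pureState, Matrix.vecMulVec_apply, Pi.star_apply]
  push_cast
  refine Finset.sum_congr rfl fun x _ => ?_
  rw [Complex.star_def, Complex.mul_conj']

theorem dotProduct_pureState_mulVec {n : Type} [Fintype n] (v ψ : n → ℂ) :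
    star v ⬝ᵥ (pureState ψ).mulVec v = ((‖star v ⬝ᵥ ψ‖ ^ 2 : ℝ) : ℂ) := by
  have h : star ψ ⬝ᵥ v = star (star v ⬝ᵥ ψ) := by
    rw [Matrix.star_dotProduct, dotProduct_comm]
  rw [pureState, Matrix.vecMulVec_mulVec, h, Complex.ofReal_pow, ← Complex.mul_conj']
  simp [dotProduct_smul, mul_comm]

/-- The unit vectors that occur in a decomposition of a pure state are multiples of its vector. -/
theorem exists_smul_of_pureState_eq_sum {n : Type} [Fintype n] {ψ : n → ℂ}
    (hψ : ∑ x, ‖ψ x‖ ^ 2 = 1) {N : ℕ} {p : Fin N → ℝ} {φ : Fin N → n → ℂ} (hp : ∀ i, 0 ≤ p i)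
    (h : pureState ψ = ∑ i, (p i : ℂ) • pureState (φ i)) {i : Fin N} (hi : p i ≠ 0) :
    ∃ c : ℂ, φ i = c • ψ := by
  have hψ1 : star ψ ⬝ᵥ ψ = 1 := by
    have := trace_pureState ψ
    rw [hψ, pureState, Matrix.trace_vecMulVec, dotProduct_comm] at this
    simpa using this
  refine ⟨star ψ ⬝ᵥ φ i, ?_⟩
  -- The component `v` of `φ i` orthogonal to `ψ` has expectation zero in the state.
  set v := φ i - (star ψ ⬝ᵥ φ i) • ψ with hv
  have hψv : star ψ ⬝ᵥ v = 0 := by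
    rw [hv, dotProduct_sub, dotProduct_smul, hψ1, smul_eq_mul, mul_one, sub_self]
  have hvψ : star v ⬝ᵥ ψ = 0 := by
    rw [← star_star (star v ⬝ᵥ ψ), ← Matrix.star_dotProduct, hψv, star_zero]
  have h0 : ∑ j, p j * ‖star v ⬝ᵥ φ j‖ ^ 2 = 0 := by
    have := congrArg (fun M : Matrix n n ℂ => star v ⬝ᵥ M.mulVec v) h
    simp only [dotProduct_pureState_mulVec, hvψ, Matrix.sum_mulVec, dotProduct_sum,
      Matrix.smul_mulVec, dotProduct_smul] at this
    simp only [norm_zero, smul_eq_mul] at this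
    have h2 : ((∑ j, p j * ‖star v ⬝ᵥ φ j‖ ^ 2 : ℝ) : ℂ) = 0 := by
      push_cast
      push_cast at this
      rw [← this]
      simp
    exact_mod_cast h2
  have h1 := (Finset.sum_eq_zero_iff_of_nonneg
    fun j _ => mul_nonneg (hp j) (sq_nonneg ‖star v ⬝ᵥ φ j‖)).1 h0 i (Finset.mem_univ i)
  have h2 : star v ⬝ᵥ φ i = 0 := by simpa [hi] using h1
  have h3 : star v ⬝ᵥ v = 0 := by
    conv_lhs => rw [hv]
    rw [dotProduct_sub, dotProduct_smul, h2, hvψ]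
    simp
  exact sub_eq_zero.1 (dotProduct_star_self_eq_zero.1 h3)

theorem pureConcurrence_smul (c : ℂ) (ψ : Fin 2 × Fin 2 → ℂ) :
    pureConcurrence (c • ψ) = ‖c‖ ^ 2 * pureConcurrence ψ := by
  simp only [pureConcurrence, Pi.smul_apply, smul_eq_mul]
  rw [show c * ψ (0, 0) * (c * ψ (1, 1)) - c * ψ (0, 1) * (c * ψ (1, 0)) =
    c ^ 2 * (ψ (0, 0) * ψ (1, 1) - ψ (0, 1) * ψ (1, 0)) by ring, norm_mul, norm_pow]
  ring

theorem concurrence_pureState {ψ : Fin 2 × Fin 2 → ℂ} (hψ : ∑ x, ‖ψ x‖ ^ 2 = 1) :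
    concurrence (pureState ψ) = pureConcurrence ψ := by
  refine (congrArg sInf ?_).trans (csInf_singleton (pureConcurrence ψ))
  refine Set.eq_singleton_iff_unique_mem.2 ⟨?_, ?_⟩
  · exact ⟨1, fun _ => 1, fun _ => ψ, fun _ => zero_le_one, fun _ => hψ, by simp, by simp⟩
  · rintro r ⟨N, p, φ, hp, hφ, h, rfl⟩
    have hsum : ∑ i, p i = 1 := by
      have := congrArg Matrix.trace h
      simp only [Matrix.trace_sum, Matrix.trace_smul, trace_pureState, hφ, hψ] at this
      have h2 : ((∑ i, p i : ℝ) : ℂ) = 1 := by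
        push_cast
        simpa using this.symm
      exact_mod_cast h2
    have : ∀ i, p i * pureConcurrence (φ i) = p i * pureConcurrence ψ := fun i => by
      by_cases hi : p i = 0
      · simp [hi]
      obtain ⟨c, hc⟩ := exists_smul_of_pureState_eq_sum hψ hp h hi
      have h1 := hφ i
      simp only [hc, Pi.smul_apply, norm_smul, mul_pow, ← Finset.mul_sum, hψ, mul_one] at h1
      rw [hc, pureConcurrence_smul, h1, one_mul]
    simp only [this, ← Finset.sum_mul, hsum, one_mul]

/-! ### The outputs on the W state -/

theorem outputOnW_apply (i : Fin 3) (x y : Qubits3) :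
    outputOnW i x y =
      krausDiag i x.1 * (wState x * star (wState y)) * star (krausDiag i y.1) :=
  piInstrument_apply i _ _ _

/-- `√(2/3) |10⟩ + √(1/3) |01⟩`, the state shared with `C` after either of the first two
outcomes. -/
def outcomeVec : Fin 2 × Fin 2 → ℂ := fun x =>
  if x = (1, 0) then (√2 : ℂ) / √3 else if x = (0, 1) then 1 / (√3 : ℂ) else 0

theorem norm_sq_outcomeVec : ∑ x, ‖outcomeVec x‖ ^ 2 = 1 := by
  simp [outcomeVec, Fintype.sum_prod_type, Fin.sum_univ_two, div_pow]
  norm_num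

theorem isDensity_outcomeVec : IsDensity (pureState outcomeVec) := by
  refine ⟨Matrix.posSemidef_vecMulVec_self_star _, ?_⟩
  rw [trace_pureState, norm_sq_outcomeVec, Complex.ofReal_one]

theorem concurrence_outcomeVec : concurrence (pureState outcomeVec) = 2 * √2 / 3 := by
  rw [concurrence_pureState norm_sq_outcomeVec, pureConcurrence]
  have h3 : √3 * √3 = 3 := Real.mul_self_sqrt (by norm_num)
  have h0 : √3 ≠ 0 := by positivity
  simp [outcomeVec]
  rw [abs_of_nonneg (Real.sqrt_nonneg 2), abs_of_nonneg (Real.sqrt_nonneg 3)]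
  field_simp
  linear_combination (-1 : ℝ) * h3

/-- The amplitudes of `Π₁ ⊗ 1` applied to `|W⟩`. -/
theorem krausDiag_zero_mul_wState (x : Qubits3) :
    krausDiag 0 x.1 * wState x = if x.1.2 = 0 then 1 / √2 * outcomeVec (x.1.1, x.2) else 0 := by
  have h' := sqrt_two_ne_zero
  obtain ⟨⟨a, b⟩, c⟩ := x
  fin_cases a <;> fin_cases b <;> fin_cases c <;> simp [krausDiag, wState, outcomeVec] <;>
    field_simp

/-- The amplitudes of `Π₂ ⊗ 1` applied to `|W⟩`. -/
theorem krausDiag_one_mul_wState (x : Qubits3) :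
    krausDiag 1 x.1 * wState x = if x.1.1 = 0 then 1 / √2 * outcomeVec (x.1.2, x.2) else 0 := by
  have h' := sqrt_two_ne_zero
  obtain ⟨⟨a, b⟩, c⟩ := x
  fin_cases a <;> fin_cases b <;> fin_cases c <;> simp [krausDiag, wState, outcomeVec] <;>
    field_simp

theorem krausDiag_two_mul_wState (x : Qubits3) : krausDiag 2 x.1 * wState x = 0 := by
  obtain ⟨⟨a, b⟩, c⟩ := x
  fin_cases a <;> fin_cases b <;> fin_cases c <;> simp [krausDiag, wState]

theorem outputOnW_eq_mul_star (i : Fin 3) (x y : Qubits3) :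
    outputOnW i x y = krausDiag i x.1 * wState x * star (krausDiag i y.1 * wState y) := by
  rw [outputOnW_apply, star_mul']
  ring

theorem amplitude_mul_star (z w : ℂ) :
    1 / (√2 : ℂ) * z * star (1 / (√2 : ℂ) * w) = (1 / 2 : ℂ) * (z * star w) := by
  have h : (√2 : ℂ)⁻¹ * (√2 : ℂ)⁻¹ = 1 / 2 := by rw [← mul_inv, sqrt_two_mul_self, one_div]
  simp only [one_div, star_mul', star_inv₀, Complex.star_def, Complex.conj_ofReal]
  linear_combination (z * starRingEnd ℂ w) * h

theorem outputOnW_zero :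
    outputOnW 0 = (1 / 2 : ℂ) • placeAC (pureState outcomeVec) := by
  ext x y
  rw [outputOnW_eq_mul_star, krausDiag_zero_mul_wState, krausDiag_zero_mul_wState,
    Matrix.smul_apply, placeAC, Matrix.of_apply]
  by_cases hx : x.1.2 = 0 <;> by_cases hy : y.1.2 = 0 <;>
    simp only [hx, hy, if_true, if_false, and_self, and_true, and_false, star_zero,
      mul_zero, zero_mul, smul_zero]
  exact amplitude_mul_star _ _

theorem outputOnW_one :
    outputOnW 1 = (1 / 2 : ℂ) • placeBC (pureState outcomeVec) := by
  ext x y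
  rw [outputOnW_eq_mul_star, krausDiag_one_mul_wState, krausDiag_one_mul_wState,
    Matrix.smul_apply, placeBC, Matrix.of_apply]
  by_cases hx : x.1.1 = 0 <;> by_cases hy : y.1.1 = 0 <;>
    simp only [hx, hy, if_true, if_false, and_self, and_true, and_false, star_zero,
      mul_zero, zero_mul, smul_zero]
  exact amplitude_mul_star _ _

theorem outputOnW_two : outputOnW 2 = 0 := by
  ext x y
  rw [outputOnW_eq_mul_star, krausDiag_two_mul_wState, zero_mul, Matrix.zero_apply]

theorem trace_placeAC (ω : Matrix (Fin 2 × Fin 2) (Fin 2 × Fin 2) ℂ) :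
    (placeAC ω).trace = ω.trace := by
  simp [Matrix.trace, placeAC, Fintype.sum_prod_type, Fin.sum_univ_two]

theorem trace_placeBC (ω : Matrix (Fin 2 × Fin 2) (Fin 2 × Fin 2) ℂ) :
    (placeBC ω).trace = ω.trace := by
  simp [Matrix.trace, placeBC, Fintype.sum_prod_type, Fin.sum_univ_two]

end LOCCGap

end

open LOCCGap
theorem mainTheorem5 :
    (∑ i, (krausOp i).conjTranspose * krausOp i = 1) ∧
    piInstrument ∈ SEP (Fin 3) (Fin 2) (Fin 2) ∧
    (∃ (p : Fin 3 → ℝ) (ω₁ ω₂ : Matrix (Fin 2 × Fin 2) (Fin 2 × Fin 2) ℂ),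
      (∀ i, (outputOnW i).trace = (p i : ℂ)) ∧
      p 0 = 1 / 2 ∧ p 1 = 1 / 2 ∧ p 2 = 0 ∧
      IsDensity ω₁ ∧ IsDensity ω₂ ∧
      outputOnW 0 = (p 0 : ℂ) • placeAC ω₁ ∧
      outputOnW 1 = (p 1 : ℂ) • placeBC ω₂ ∧
      outputOnW 2 = 0 ∧
      p 0 * concurrence ω₁ + p 1 * concurrence ω₂ = 2 * Real.sqrt 2 / 3) ∧
    2 * Real.sqrt 2 / 3 > (8 / 9 : ℝ) ∧
    piInstrument ∉ instrClosure (LOCCN (Fin 3) (Fin 2) (Fin 2)) ∧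
    piInstrument ∉ instrClosure (LOCC (Fin 3) (Fin 2) (Fin 2)) ∧
    ¬ SEP (Fin 3) (Fin 2) (Fin 2) ⊆ instrClosure (LOCC (Fin 3) (Fin 2) (Fin 2)) := by
  have hLOCC : piInstrument ∉ instrClosure (LOCC (Fin 3) (Fin 2) (Fin 2)) :=
    piInstrument_notMem_closure fun _ => coherence_le_of_mem_LOCC
  have hhalf : ((1 / 2 : ℝ) : ℂ) = 1 / 2 := by norm_num
  refine ⟨sum_krausOp, piInstrument_mem_SEP,
    ⟨![1 / 2, 1 / 2, 0], pureState outcomeVec, pureState outcomeVec, fun i => ?_, rfl, rfl, rfl,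
      isDensity_outcomeVec, isDensity_outcomeVec, ?_, ?_, outputOnW_two, ?_⟩, ?_,
    piInstrument_notMem_closure fun _ => coherence_le_of_mem_LOCCN, hLOCC,
    fun h => hLOCC (h piInstrument_mem_SEP)⟩
  · fin_cases i
    · change (outputOnW 0).trace = ((1 / 2 : ℝ) : ℂ)
      rw [outputOnW_zero, Matrix.trace_smul, trace_placeAC, isDensity_outcomeVec.2, hhalf,
        smul_eq_mul, mul_one]
    · change (outputOnW 1).trace = ((1 / 2 : ℝ) : ℂ)
      rw [outputOnW_one, Matrix.trace_smul, trace_placeBC, isDensity_outcomeVec.2, hhalf,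
        smul_eq_mul, mul_one]
    · change (outputOnW 2).trace = ((0 : ℝ) : ℂ)
      rw [outputOnW_two, Matrix.trace_zero, Complex.ofReal_zero]
  · exact outputOnW_zero.trans (by rw [← hhalf]; rfl)
  · exact outputOnW_one.trans (by rw [← hhalf]; rfl)
  · change 1 / 2 * concurrence _ + 1 / 2 * concurrence _ = _
    rw [concurrence_outcomeVec]
    ring
  · have : (4 / 3 : ℝ) < √2 := by
      rw [Real.lt_sqrt (by norm_num)]
      norm_num
    linarith
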